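/- Let $S^1=\mathbb R/\mathbb Z$, let $M$ be a smooth (finite-dimensional, boundaryless) manifold with an exact symplectic form $\omega=d\lambda$ (for instance the completion $\hat W$ of a Liouville domain), and let $H:S^1\times M\to\mathbb R$ be a smooth time-dependent Hamiltonian, $H^\theta=H(\theta,\cdot)$. The Hamiltonian vector field of $h$ is defined by $\omega(X_h,\cdot)=dh$, and $\mathcal P(H)$ is the set of smooth loops $\gamma:S^1\to M$ with $\dot\gamma(\theta)=X_{H^\theta}(\gamma(\theta))$. For $K\subseteq M$ put $$\|H\|_K=\int_{S^1}\Big(\sup_{x\in K}H(\theta,x)-\inf_{x\in K}H(\theta,x)\Big)\,d\theta\in[0,\infty],$$ and let $\|H\|=\|H\|_M$ be the Hofer norm. Let $N\ge 0$, $a_0,\dots,a_N\in\mathbb R$, let $f:\mathbb CP^N\to\mathbb R$ be $f([z_0:\dots:z_N])=\sum_{j=0}^N a_j|z_j|^2/\|z\|^2$, and let $\tilde f$ be its lift to the unit sphere $S^{2N+1}\subset\mathbb C^{N+1}$. Define $\arg z\in\mathbb R/\mathbb Z$ by $z=|z|e^{2\pi i\arg z}$ for $z\ne0$, and $$H_{N,f}(\theta,x,z)=\sum_{j=0}^N|z_j|^2H^{\theta-\arg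 z_j}(x)+\tilde f(z),\qquad (\theta,x,z)\in S^1\times M\times S^{2N+1},$$ where the terms with $z_j=0$ are zero. On $\mathcal LM\times S^{2N+1}$, with $\mathcal LM=C^\infty(S^1,M)$, consider the parametrized action functional $$\mathcal A_{H_{N,f}}(\gamma,z)=-\int_{S^1}\gamma^*\lambda-\int_{S^1}H_{N,f}(\theta,\gamma(\theta),z)\,d\theta .$$ A point $(\gamma,z)$ is critical if the derivative at $s=0$ of $\mathcal A_{H_{N,f}}(\gamma_s,z_s)$ exists and vanishes for every smooth one-parameter family $(\gamma_s,z_s)_{s\in\mathbb R}$ with $(\gamma_0,z_0)=(\gamma,z)$. Let $S^1$ act by $\tau\cdot(\gamma,z)=(\gamma(\cdot-\tau),e^{2\pi i\tau}z)$, and let $Z_j\in S^{2N+1}$ be the vector whose $j$-th component is $1$. (i) $S^1\cdot\big(\mathcal P(H)\times\{Z_j: j=0,\dots,N\}\big)\subseteq\mathrm{Crit}(\mathcal A_{H_{N,f}})$. (ii) If $a_j-a_{j-1}>\|H\|$ for all $j=1,\dots,N$, then equality holds in (i). More generally, if $K\subseteq M$ is any subset and $a_j-a_{j-1}>\|H\|_K$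 for all $j=1,\dots,N$, then the critical points $(\gamma,z)$ of $\mathcal A_{H_{N,f}}$ with $\gamma(S^1)\subseteq K$ are exactly the points of $S^1\cdot\big(\{\gamma\in\mathcal P(H):\gamma(S^1)\subseteq K\}\times\{Z_j: j=0,\dots,N\}\big)$. -/

import Mathlib

open Set MeasureTheory Bundle
open scoped Manifold ContDiff ENNReal LinearAlgebra.Projectivization

noncomputable section

namespace JoinExtension

section Manifold

variable {E : Type*} [NormedAddCommGroup E] [NormedSpace ℝ E]
  {M : Type*} [TopologicalSpace M] [ChartedSpace E M]

/-- The local expression of a `1`-form `lam` in the preferred chart at `x`: the pull-back of `lam`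
under the inverse of this chart, a `1`-form on (an open subset of) the model space `E`. -/
def localForm (lam : ∀ x : M, TangentSpace 𝓘(ℝ, E) x →L[ℝ] ℝ) (x : M) (y : E) : E →L[ℝ] ℝ :=
  (lam ((extChartAt 𝓘(ℝ, E) x).symm y)).comp
    (mfderiv 𝓘(ℝ, E) 𝓘(ℝ, E) (extChartAt 𝓘(ℝ, E) x).symm y)

/-- The exterior derivative `(d lam)_x (u, v)` of a `1`-form, computed in the preferred chart
at `x` as `D L (u) v - D L (v) u` with `L` the local expression of `lam`. -/
def extDerivOneForm (lam : ∀ x : M, TangentSpace 𝓘(ℝ, E) x →L[ℝ] ℝ) (x : M)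
    (u v : TangentSpace 𝓘(ℝ, E) x) : ℝ :=
  let D : E →L[ℝ] E →L[ℝ] ℝ := fderiv ℝ (localForm lam x) (extChartAt 𝓘(ℝ, E) x x)
  let dchart : TangentSpace 𝓘(ℝ, E) x →L[ℝ] E :=
    mfderiv 𝓘(ℝ, E) 𝓘(ℝ, E) (extChartAt 𝓘(ℝ, E) x) x
  D (dchart u) (dchart v) - D (dchart v) (dchart u)

variable (E M) in
/-- An exact symplectic structure on `M`: a smooth `1`-form whose exterior derivative is
nondegenerate. The symplectic form is `d form`. -/
structure ExactSymplectic [IsManifold 𝓘(ℝ, E) ∞ M] where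
  /-- the primitive of the symplectic form -/
  form : ∀ x : M, TangentSpace 𝓘(ℝ, E) x →L[ℝ] ℝ
  contMDiff : ContMDiff 𝓘(ℝ, E) (𝓘(ℝ, E).prod 𝓘(ℝ, E →L[ℝ] ℝ)) ∞
    (fun x : M ↦ TotalSpace.mk' (E →L[ℝ] ℝ)
      (E := fun x : M ↦ TangentSpace 𝓘(ℝ, E) x →L[ℝ] ℝ) x (form x))
  nondegenerate : ∀ (x : M) (u : TangentSpace 𝓘(ℝ, E) x),
    (∀ v, extDerivOneForm form x u v = 0) → u = 0

variable (E M) in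
/-- The free loop space: smooth maps from `S¹ = ℝ / ℤ` to `M`. -/
structure FreeLoop where
  toFun : UnitAddCircle → M
  contMDiff : ContMDiff 𝓘(ℝ, ℝ) 𝓘(ℝ, E) ∞ (fun t : ℝ ↦ toFun t)

instance : CoeFun (FreeLoop E M) (fun _ ↦ UnitAddCircle → M) := ⟨FreeLoop.toFun⟩

/-- The velocity of a loop at (the class of) the time `t`. -/
def FreeLoop.velocity (γ : FreeLoop E M) (t : ℝ) : TangentSpace 𝓘(ℝ, E) (γ t) :=
  mfderiv 𝓘(ℝ, ℝ) 𝓘(ℝ, E) (fun s : ℝ ↦ γ s) t (1 : ℝ)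

/-- The action of `S¹` on loops by reparametrization, `(τ • γ)(θ) = γ (θ - τ)`. -/
def FreeLoop.rotate (τ : UnitAddCircle) (γ : FreeLoop E M) : FreeLoop E M where
  toFun θ := γ (θ - τ)
  contMDiff := by
    induction τ using QuotientAddGroup.induction_on with
    | H r =>
      have h : ContMDiff 𝓘(ℝ, ℝ) 𝓘(ℝ, ℝ) ∞ (fun t : ℝ ↦ t - r) :=
        (contDiff_id.sub contDiff_const).contMDiff
      exact γ.contMDiff.comp h

/-- The Hamiltonian vector field of a function `h` at `x`: the vector `X` with
`ω (X, ·) = dh`, where `ω = d (σ.form)` is the symplectic form. It exists and is unique on a finite dimensional manifold,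
by nondegeneracy of the symplectic form. -/
def hamVec [IsManifold 𝓘(ℝ, E) ∞ M] (σ : ExactSymplectic E M) (h : M → ℝ) (x : M) :
    TangentSpace 𝓘(ℝ, E) x :=
  Classical.epsilon fun X ↦ ∀ v, extDerivOneForm σ.form x X v = mvfderiv 𝓘(ℝ, E) h x v

/-- The set of `1`-periodic orbits of a time-dependent Hamiltonian. -/
def periodicOrbits [IsManifold 𝓘(ℝ, E) ∞ M] (σ : ExactSymplectic E M)
    (H : UnitAddCircle → M → ℝ) : Set (FreeLoop E M) :=
  {γ | ∀ t : ℝ, γ.velocity t = hamVec σ (H t) (γ t)}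

end Manifold

section HoferNorm

variable {M : Type*}

/-- The Hofer norm `∫ (sup_{x ∈ K} H (θ, x) - inf_{x ∈ K} H (θ, x)) dθ` over a subset `K`,
an element of `[0, ∞]`. -/
def hoferNormOn (K : Set M) (H : UnitAddCircle → M → ℝ) : ℝ≥0∞ :=
  ∫⁻ θ : UnitAddCircle, ((⨆ x ∈ K, (H θ x : EReal)) - ⨅ x ∈ K, (H θ x : EReal)).toENNReal

/-- The Hofer norm `∫ (max_x H (θ, x) - min_x H (θ, x)) dθ`, an element of `[0, ∞]`. -/
def hoferNorm (H : UnitAddCircle → M → ℝ) : ℝ≥0∞ := hoferNormOn univ H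

end HoferNorm

/-- `ℂ ^ (N + 1)` with its Hermitian norm. -/
abbrev CSpace (N : ℕ) : Type := EuclideanSpace ℂ (Fin (N + 1))

/-- The unit sphere `S ^ (2 N + 1)` of `ℂ ^ (N + 1)`. -/
abbrev CSphere (N : ℕ) : Type := Metric.sphere (0 : CSpace N) 1

/-- The argument in `ℝ / ℤ`, characterized by `z = |z| e ^ (2 π i arg z)` for `z ≠ 0`. -/
def circleArg (z : ℂ) : UnitAddCircle := ((Complex.arg z / (2 * Real.pi) : ℝ) : UnitAddCircle)

/-- The function `[z] ↦ ∑ j, a j |z j|² / ‖z‖²` on the complex projective space. -/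
def projFun {N : ℕ} (a : Fin (N + 1) → ℝ) : ℙ ℂ (CSpace N) → ℝ :=
  Projectivization.lift (fun v ↦ (∑ j, a j * ‖v.1 j‖ ^ 2) / ‖v.1‖ ^ 2) (by
    rintro ⟨v, hv⟩ ⟨w, hw⟩ t h
    simp only at h
    subst h
    have ht : t ≠ 0 := by
      rintro rfl
      simp at hv
    have h2 : ‖t‖ ^ 2 ≠ 0 := by positivity
    simp only [PiLp.smul_apply, norm_smul, mul_pow]
    rw [← mul_div_mul_left _ (‖w‖ ^ 2) h2, Finset.mul_sum]
    congr 1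
    exact Finset.sum_congr rfl fun j _ ↦ by ring)

/-- The lift to the sphere of a function on the projective space. -/
def sphereLift {N : ℕ} (f : ℙ ℂ (CSpace N) → ℝ) (z : CSphere N) : ℝ :=
  f (Projectivization.mk ℂ (z : CSpace N) (ne_zero_of_mem_unit_sphere z))

/-- The vector `Z j` of the sphere whose `j`-th component is `1`. -/
def basisPt (N : ℕ) (j : Fin (N + 1)) : CSphere N :=
  ⟨EuclideanSpace.single j (1 : ℂ), by simp⟩

/-- The action of `S¹ = ℝ / ℤ` on the sphere, `τ • z = e ^ (2 π i τ) z`. -/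
def sphereRotate {N : ℕ} (τ : UnitAddCircle) (z : CSphere N) : CSphere N :=
  ⟨((AddCircle.toCircle τ : Circle) : ℂ) • (z : CSpace N), by
    rw [mem_sphere_zero_iff_norm, norm_smul, Circle.norm_coe, norm_eq_of_mem_sphere, one_mul]⟩

section Families

variable {M : Type*}

/-- The join-type extension `H_{N,0} (θ, x, z) = ∑ j, |z j|² H (θ - arg (z j), x)`. -/
def joinExt {N : ℕ} (H : UnitAddCircle → M → ℝ) (θ : UnitAddCircle) (x : M) (z : CSphere N) : ℝ :=
  ∑ j, ‖(z : CSpace N) j‖ ^ 2 * H (θ - circleArg ((z : CSpace N) j)) x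

/-- `H_{N,f} (θ, x, z) = H_{N,0} (θ, x, z) + f̃ (z)`, with `f̃` the lift of `f` to the sphere. -/
def joinExtAdd {N : ℕ} (H : UnitAddCircle → M → ℝ) (f : ℙ ℂ (CSpace N) → ℝ)
    (θ : UnitAddCircle) (x : M) (z : CSphere N) : ℝ :=
  joinExt H θ x z + sphereLift f z

end Families

section Action

variable {E : Type*} [NormedAddCommGroup E] [NormedSpace ℝ E]
  {M : Type*} [TopologicalSpace M] [ChartedSpace E M] [IsManifold 𝓘(ℝ, E) ∞ M] {N : ℕ}

/-- The parametrized action functional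
`𝒜 (γ, z) = - ∫ γ^* lam - ∫ H (θ, γ θ, z) dθ` on `(free loop space) × S ^ (2 N + 1)`. -/
def action (σ : ExactSymplectic E M) (H : UnitAddCircle → M → CSphere N → ℝ)
    (p : FreeLoop E M × CSphere N) : ℝ :=
  -(∫ t in (0 : ℝ)..1, σ.form (p.1 t) (p.1.velocity t))
    - ∫ t in (0 : ℝ)..1, H (t : UnitAddCircle) (p.1 t) p.2

/-- A smooth one-parameter family in `(free loop space) × S ^ (2 N + 1)`: a smooth map
`ℝ × S¹ → M` together with a smooth curve in the sphere. -/
structure IsSmoothFamily (c : ℝ → FreeLoop E M × CSphere N) : Prop where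
  loop : ContMDiff 𝓘(ℝ, ℝ × ℝ) 𝓘(ℝ, E) ∞ (fun q : ℝ × ℝ ↦ (c q.1).1 (q.2 : UnitAddCircle))
  sphere : ContDiff ℝ ∞ (fun s ↦ ((c s).2 : CSpace N))

/-- The set of critical points of a functional on `(free loop space) × S ^ (2 N + 1)`: the points
where its derivative along every smooth one-parameter family vanishes. -/
def Crit (A : FreeLoop E M × CSphere N → ℝ) : Set (FreeLoop E M × CSphere N) :=
  {p | ∀ c : ℝ → FreeLoop E M × CSphere N, IsSmoothFamily c → c 0 = p →
    HasDerivAt (fun s ↦ A (c s)) 0 0}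

/-- The union of the orbits of the points of `S` under the diagonal action of `S¹`. -/
def orbits (S : Set (FreeLoop E M × CSphere N)) : Set (FreeLoop E M × CSphere N) :=
  {q | ∃ τ : UnitAddCircle, ∃ p ∈ S, q = (p.1.rotate τ, sphereRotate τ p.2)}

end Action

end JoinExtension

end

open JoinExtension

/-! Write `h(φ) = ∫ H(t - φ, γ(t)) dt` (`loopHam`). Then the action at `(γ, z)` is `-∫ γ^*λ - ∑
|z_j|² b_j` with `b_j = h(arg z_j) + a_j` (`action_joinExtAdd`).

Critical points lie on the orbits. Varying only the moduli `|z_j|`, under the constraint `∑ |z_j|² =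
1`, gives a Lagrange multiplier condition: `b_j` has the same value for every `j` with `z_j ≠ 0`
(`weight_eq_of_mem_Crit`). Two values of `h` differ by at most `‖H‖_K` if `γ` stays in `K`
(`ofReal_loopHam_sub_le`). If `z_j` and `z_k` were both nonzero with `j < k`, then `a_k - a_j` would
be at most `‖H‖_K`, which is less than `a_{j+1} - a_j ≤ a_k - a_j`, a contradiction. So `z` is `Z_j`
up to a phase `r`. Varying `γ` alone, the fundamental lemma of the calculus of variations then gives
`γ' = X_{H(t - r)}`, and rotating back by `r` yields a periodic orbit of `H` paired with `Z_j`.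

Conversely, at such a point the coordinates `z_i` with `i ≠ j` vanish, and although their phases may
jump, their terms are `O(s²)` along any family. The remaining part is the action for `H` delayed by
a smooth phase `α(s)`. Its first variation (`exists_first_variation`) has density `ω(∂_sΓ, γ') +
dH(∂_sΓ + α' γ')`. This vanishes when `γ' = X_H`, because `dH(v) = ω(γ', v)` and `ω` is alternating.
-/

namespace JoinExtension

open Filter Topology

/-! ### Charts and the local expression of the primitive -/

section Local

variable {E : Type*} [NormedAddCommGroup E] [NormedSpace ℝ E]
  {M : Type*} [TopologicalSpace M] [ChartedSpace E M] [IsManifold 𝓘(ℝ, E) ∞ M]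
  {V : Type*} [NormedAddCommGroup V] [NormedSpace ℝ V]

/-- The preferred chart at `x`. -/
noncomputable abbrev chart (E : Type*) [NormedAddCommGroup E] [NormedSpace ℝ E]
    {M : Type*} [TopologicalSpace M] [ChartedSpace E M] (x : M) : M → E :=
  extChartAt 𝓘(ℝ, E) x

theorem isManifold_one : IsManifold 𝓘(ℝ, E) 1 M := IsManifold.of_le (n := ∞) (by simp)

theorem mdifferentiableAt_chart {x p : M} (hp : p ∈ (chartAt E x).source) :
    MDifferentiableAt 𝓘(ℝ, E) 𝓘(ℝ, E) (chart E x) p :=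
  have : IsManifold 𝓘(ℝ, E) 1 M := isManifold_one
  mdifferentiableAt_extChartAt hp

theorem contMDiffAt_chart {x p : M} (hp : p ∈ (chartAt E x).source) :
    ContMDiffAt 𝓘(ℝ, E) 𝓘(ℝ, E) ∞ (chart E x) p :=
  contMDiffAt_extChartAt' hp

theorem contMDiffAt_chart_symm {x : M} {y : E} (hy : y ∈ (extChartAt 𝓘(ℝ, E) x).target) :
    ContMDiffAt 𝓘(ℝ, E) 𝓘(ℝ, E) ∞ (extChartAt 𝓘(ℝ, E) x).symm y :=
  (contMDiffOn_extChartAt_symm x y hy).contMDiffAt (extChartAt_target_mem_nhds' hy)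

theorem contDiffAt_chart_comp {x : M} {g : V → M} {q : V}
    (hg : ContMDiffAt 𝓘(ℝ, V) 𝓘(ℝ, E) ∞ g q) (hq : g q ∈ (chartAt E x).source) :
    ContDiffAt ℝ ∞ (fun q ↦ chart E x (g q)) q :=
  ((contMDiffAt_chart hq).comp q hg).contDiffAt

theorem mfderiv_eq_fderiv_chart {g : V → M} {q : V}
    (hg : MDifferentiableAt 𝓘(ℝ, V) 𝓘(ℝ, E) g q) (w : V) :
    (mfderiv 𝓘(ℝ, V) 𝓘(ℝ, E) g q w : E) = fderiv ℝ (fun q' ↦ chart E (g q) (g q')) q w := by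
  have : IsManifold 𝓘(ℝ, E) 1 M := isManifold_one
  have h := mfderiv_comp q (mdifferentiableAt_chart (E := E) (mem_chart_source E (g q))) hg
  rw [mfderiv_extChartAt_self, mfderiv_eq_fderiv] at h
  exact (congrArg (fun A : V →L[ℝ] E ↦ A w) h).symm

theorem extDerivOneForm_eq (lam : ∀ x : M, TangentSpace 𝓘(ℝ, E) x →L[ℝ] ℝ) (x : M) (u v : E) :
    extDerivOneForm lam x u v = fderiv ℝ (localForm lam x) (chart E x x) u v
      - fderiv ℝ (localForm lam x) (chart E x x) v u := by
  have : IsManifold 𝓘(ℝ, E) 1 M := isManifold_one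
  unfold extDerivOneForm
  rw [mfderiv_extChartAt_self]
  rfl

omit [IsManifold 𝓘(ℝ, E) ∞ M] in
theorem form_congr (lam : ∀ x : M, TangentSpace 𝓘(ℝ, E) x →L[ℝ] ℝ) {p q : M} (h : p = q) :
    (lam p : E →L[ℝ] ℝ) = lam q := by
  subst h; rfl

theorem form_mfderiv_eq (lam : ∀ x : M, TangentSpace 𝓘(ℝ, E) x →L[ℝ] ℝ) {x : M} {g : V → M} {q : V}
    (hg : MDifferentiableAt 𝓘(ℝ, V) 𝓘(ℝ, E) g q) (hq : g q ∈ (chartAt E x).source) (w : V) :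
    lam (g q) (mfderiv 𝓘(ℝ, V) 𝓘(ℝ, E) g q w) =
      localForm lam x (chart E x (g q)) (fderiv ℝ (fun q' ↦ chart E x (g q')) q w) := by
  have hq' : g q ∈ (extChartAt 𝓘(ℝ, E) x).source := by rwa [extChartAt_source]
  have hc := (mdifferentiableAt_chart (E := E) hq).comp q hg
  have hs := (contMDiffAt_chart_symm ((extChartAt 𝓘(ℝ, E) x).map_source hq')).mdifferentiableAt
    (by simp)
  have h := mfderiv_comp q hs hc
  have heq : (extChartAt 𝓘(ℝ, E) x).symm ∘ (chart E x ∘ g) =ᶠ[𝓝 q] g := by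
    filter_upwards [hg.continuousAt.preimage_mem_nhds
      ((chartAt E x).open_source.mem_nhds hq)] with q' hq'
    exact (extChartAt 𝓘(ℝ, E) x).left_inv (by rwa [extChartAt_source])
  rw [heq.mfderiv_eq, mfderiv_eq_fderiv] at h
  have h1 := congrArg (fun A : V →L[ℝ] E ↦ A w) h
  have h2 : (lam (g q) : E →L[ℝ] ℝ) = lam ((extChartAt 𝓘(ℝ, E) x).symm (chart E x (g q))) :=
    form_congr lam ((extChartAt 𝓘(ℝ, E) x).left_inv hq').symm
  have h3 := congrArg (fun A : E →L[ℝ] ℝ ↦ A (mfderiv 𝓘(ℝ, V) 𝓘(ℝ, E) g q w)) h2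
  refine h3.trans ?_
  exact congrArg (lam ((extChartAt 𝓘(ℝ, E) x).symm (chart E x (g q))) : E →L[ℝ] ℝ) h1

/-- Smoothness of the primitive as a section means smoothness in the trivialization of the hom
bundle. Near `x` this trivialization is the derivative of the inverse chart, so the coordinate
expression of the section is the local form composed with the chart. -/
theorem contDiffAt_localForm (σ : ExactSymplectic E M) (x : M) :
    ContDiffAt ℝ ∞ (localForm σ.form x) (chart E x x) := by
  have : IsManifold 𝓘(ℝ, E) 1 M := isManifold_one
  have h := ((contMDiffAt_hom_bundle _).1 (σ.contMDiff x)).2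
  have hx := mem_extChartAt_source (I := 𝓘(ℝ, E)) x
  have ht := (extChartAt 𝓘(ℝ, E) x).map_source hx
  have h2 := (h.congr_of_eventuallyEq (f₁ := fun p ↦ localForm σ.form x (chart E x p)) ?_)
  · have hs := contMDiffAt_chart_symm (x := x) ht
    have h3 : ContMDiffAt 𝓘(ℝ, E) 𝓘(ℝ, E →L[ℝ] ℝ) ∞
        (fun p ↦ localForm σ.form x (chart E x p)) ((extChartAt 𝓘(ℝ, E) x).symm (chart E x x)) := by
      rw [(extChartAt 𝓘(ℝ, E) x).left_inv hx]; exact h2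
    have h4 := (h3.comp _ hs).contDiffAt
    refine h4.congr_of_eventuallyEq ?_
    filter_upwards [extChartAt_target_mem_nhds' ht] with y hy
    exact congrArg (localForm σ.form x) ((extChartAt 𝓘(ℝ, E) x).right_inv hy).symm
  · filter_upwards [(chartAt E x).open_source.mem_nhds (mem_chart_source E x)] with p hp
    have hp' : p ∈ (extChartAt 𝓘(ℝ, E) x).source := by rwa [extChartAt_source]
    have h1 := TangentBundle.symmL_trivializationAt (I := 𝓘(ℝ, E)) hp
    rw [modelWithCornersSelf_coe, range_id, mfderivWithin_univ] at h1
    have h2 : (σ.form p : E →L[ℝ] ℝ) = σ.form ((extChartAt 𝓘(ℝ, E) x).symm (chart E x p)) :=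
      form_congr σ.form ((extChartAt 𝓘(ℝ, E) x).left_inv hp').symm
    ext v
    simp only [localForm, ContinuousLinearMap.inCoordinates, ContinuousLinearMap.comp_apply]
    have h5 := congrArg (fun A : E →L[ℝ] E ↦ A v) h1
    have h6 := congrArg (fun A : E →L[ℝ] ℝ ↦ A
      (((trivializationAt E (TangentSpace 𝓘(ℝ, E)) x).symmL ℝ p : E →L[ℝ] E) v)) h2
    simp
    refine Eq.trans ?_ h6.symm
    exact congrArg (σ.form ((extChartAt 𝓘(ℝ, E) x).symm (chart E x p)) : E →L[ℝ] ℝ) h5.symm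

end Local

theorem two_le_infty : (2 : ℕ∞ω) ≤ (∞ : ℕ∞ω) := 
  WithTop.coe_le_coe.2 le_top

theorem one_add_one_le_infty : (1 + 1 : ℕ∞ω) ≤ (∞ : ℕ∞ω) :=
  one_add_one_eq_two.trans_le two_le_infty

/-- Regularity is only assumed on the slice `s = 0`, because the phase of a moving coordinate is
smooth only for small `s`. Compactness of `[0, 1]` extends it to a uniform neighbourhood, with a
constant bound on the derivative, so that dominated convergence applies. -/
theorem hasDerivAt_integral_of_contDiffAt {P : ℝ × ℝ → ℝ} (hP : ∀ t, ContDiffAt ℝ 1 P (0, t)) :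
    HasDerivAt (fun s ↦ ∫ t in (0 : ℝ)..1, P (s, t))
      (∫ t in (0 : ℝ)..1, fderiv ℝ P (0, t) (1, 0)) 0 := by
  have hcont : Continuous fun t : ℝ ↦ fderiv ℝ P (0, t) := by
    refine continuous_iff_continuousAt.2 fun t ↦ ?_
    have h := ((hP t).fderiv_right (m := 0) (by simp)).continuousAt
    exact ContinuousAt.comp (f := fun t : ℝ ↦ ((0 : ℝ), t)) h (by fun_prop)
  obtain ⟨C, hC⟩ := (isCompact_Icc (a := (0 : ℝ)) (b := 1)).exists_bound_of_continuousOn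
    hcont.continuousOn
  have hev : ∀ᶠ s in 𝓝 (0 : ℝ), ∀ t ∈ Icc (0 : ℝ) 1,
      ContDiffAt ℝ 1 P (s, t) ∧ ‖fderiv ℝ P (s, t)‖ < C + 1 := by
    refine isCompact_Icc.eventually_forall_of_forall_eventually fun t ht ↦ ?_
    have h1 := (hP t).eventually (by simp)
    have h2 := ((hP t).fderiv_right (m := 0) (by simp)).continuousAt.norm
    have h3 := h2.eventually_lt_const (lt_of_le_of_lt (hC t ht) (lt_add_one C))
    exact h1.and h3
  have hmem {t : ℝ} (ht : t ∈ Set.uIoc (0 : ℝ) 1) : t ∈ Icc (0 : ℝ) 1 := by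
    rw [uIoc_of_le zero_le_one] at ht
    exact Ioc_subset_Icc_self ht
  have hPc {s : ℝ} (hs : ∀ t ∈ Icc (0 : ℝ) 1,
      ContDiffAt ℝ 1 P (s, t) ∧ ‖fderiv ℝ P (s, t)‖ < C + 1) :
      ContinuousOn (fun t ↦ P (s, t)) (uIcc 0 1) := by
    rw [uIcc_of_le zero_le_one]
    intro t ht
    exact (ContinuousAt.comp (f := fun t : ℝ ↦ (s, t)) (hs t ht).1.continuousAt
      (by fun_prop)).continuousWithinAt
  have hint {s : ℝ} (hs : ∀ t ∈ Icc (0 : ℝ) 1,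
      ContDiffAt ℝ 1 P (s, t) ∧ ‖fderiv ℝ P (s, t)‖ < C + 1) :
      IntervalIntegrable (fun t ↦ P (s, t)) volume 0 1 := (hPc hs).intervalIntegrable
  refine (intervalIntegral.hasDerivAt_integral_of_dominated_loc_of_deriv_le
    (F := fun s t ↦ P (s, t)) (F' := fun s t ↦ fderiv ℝ P (s, t) (1, 0))
    (bound := fun _ ↦ C + 1) hev ?_ (hint hev.self_of_nhds) ?_ ?_ ?_ ?_).2
  · filter_upwards [hev] with s hs
    exact (hint hs).aestronglyMeasurable_restrict_uIoc
  · exact (hcont.clm_apply continuous_const).aestronglyMeasurable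
  · refine Eventually.of_forall fun t ht s hs ↦ ?_
    refine ((fderiv ℝ P (s, t)).le_opNorm _).trans ?_
    have h1 : ‖((1 : ℝ), (0 : ℝ))‖ = 1 := by simp [Prod.norm_def]
    rw [h1, mul_one]
    exact (hs t (hmem ht)).2.le
  · exact intervalIntegrable_const
  · refine Eventually.of_forall fun t ht s hs ↦ ?_
    have h1 : HasDerivAt (fun s : ℝ ↦ (s, t)) ((1 : ℝ), (0 : ℝ)) s :=
      (hasDerivAt_id s).prodMk (hasDerivAt_const s t)
    exact (((hs t (hmem ht)).1.differentiableAt (by simp)).hasFDerivAt).comp_hasDerivAt s h1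

/-! ### Pull-backs of the primitive and of the Hamiltonian -/

section Local

variable {E : Type*} [NormedAddCommGroup E] [NormedSpace ℝ E]
  {M : Type*} [TopologicalSpace M] [ChartedSpace E M] [IsManifold 𝓘(ℝ, E) ∞ M]
  {V : Type*} [NormedAddCommGroup V] [NormedSpace ℝ V]

/-- The pull-back of the primitive under `g`, evaluated on the constant vector field `w`. -/
noncomputable def pullForm (σ : ExactSymplectic E M) (g : V → M) (w q : V) : ℝ :=
  σ.form (g q) (mfderiv 𝓘(ℝ, V) 𝓘(ℝ, E) g q w)

theorem pullForm_eventuallyEq (σ : ExactSymplectic E M) {g : V → M}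
    (hg : ContMDiff 𝓘(ℝ, V) 𝓘(ℝ, E) ∞ g) {x : M} {q : V} (hq : g q ∈ (chartAt E x).source) (w : V) :
    pullForm σ g w =ᶠ[𝓝 q] fun q ↦ localForm σ.form x (chart E x (g q))
      (fderiv ℝ (fun q' ↦ chart E x (g q')) q w) := by
  filter_upwards [hg.continuous.continuousAt.preimage_mem_nhds
    ((chartAt E x).open_source.mem_nhds hq)] with q' hq'
  exact form_mfderiv_eq σ.form (hg.mdifferentiable (by simp) q') hq' w

theorem contDiffAt_pullForm (σ : ExactSymplectic E M) {g : V → M}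
    (hg : ContMDiff 𝓘(ℝ, V) 𝓘(ℝ, E) ∞ g) (w q : V) : ContDiffAt ℝ 1 (pullForm σ g w) q := by
  have hq := mem_chart_source E (g q)
  refine ContDiffAt.congr_of_eventuallyEq ?_ (pullForm_eventuallyEq σ hg hq w)
  have hu := contDiffAt_chart_comp (hg q) hq
  have h1 : ContDiffAt ℝ 1 (fun q' ↦ localForm σ.form (g q) (chart E (g q) (g q'))) q :=
    ((contDiffAt_localForm σ (g q)).comp q hu).of_le (by simp)
  have h2 : ContDiffAt ℝ 1 (fderiv ℝ (fun q' ↦ chart E (g q) (g q'))) q :=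
    hu.fderiv_right one_add_one_le_infty
  exact h1.clm_apply (h2.clm_apply contDiffAt_const)

/-- The exterior derivative commutes with pull-back, in an arbitrary chart. -/
theorem fderiv_pullForm_sub (σ : ExactSymplectic E M) {g : V → M}
    (hg : ContMDiff 𝓘(ℝ, V) 𝓘(ℝ, E) ∞ g) {x : M} {q : V} (hq : g q ∈ (chartAt E x).source)
    (hL : DifferentiableAt ℝ (localForm σ.form x) (chart E x (g q))) (v w : V) :
    fderiv ℝ (pullForm σ g w) q v - fderiv ℝ (pullForm σ g v) q w =
      fderiv ℝ (localForm σ.form x) (chart E x (g q))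
          (fderiv ℝ (fun q' ↦ chart E x (g q')) q v) (fderiv ℝ (fun q' ↦ chart E x (g q')) q w)
      - fderiv ℝ (localForm σ.form x) (chart E x (g q))
          (fderiv ℝ (fun q' ↦ chart E x (g q')) q w)
          (fderiv ℝ (fun q' ↦ chart E x (g q')) q v) := by
  have hu := contDiffAt_chart_comp (hg q) hq
  have hd := (hu.differentiableAt (by simp)).hasFDerivAt
  have h2 : DifferentiableAt ℝ (fderiv ℝ (fun q' ↦ chart E x (g q'))) q :=
    (hu.fderiv_right (m := 1) one_add_one_le_infty).differentiableAt (by simp)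
  have key (w : V) := (HasFDerivAt.comp q hL.hasFDerivAt hd).clm_apply
    (h2.hasFDerivAt.clm_apply (hasFDerivAt_const w q))
  -- The two terms in which the form is applied to a second derivative of the coordinate map cancel
  -- by symmetry.
  have hsymm := hu.isSymmSndFDerivAt (by simpa using two_le_infty) v w
  rw [(pullForm_eventuallyEq σ hg hq w).fderiv_eq, (pullForm_eventuallyEq σ hg hq v).fderiv_eq]
  have kw := (key w).fderiv
  have kv := (key v).fderiv
  simp only [Function.comp_def] at kw kv
  rw [kw, kv]
  simp [hsymm]

/-- The local expression of a time-dependent function in the preferred chart at `x`. -/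
noncomputable def localHam (H : UnitAddCircle → M → ℝ) (x : M) (q : ℝ × E) : ℝ :=
  H (q.1 : UnitAddCircle) ((extChartAt 𝓘(ℝ, E) x).symm q.2)

variable {H : UnitAddCircle → M → ℝ}
  (hH : ContMDiff (𝓘(ℝ, ℝ).prod 𝓘(ℝ, E)) 𝓘(ℝ, ℝ) ∞
    (fun p : ℝ × M ↦ H (p.1 : UnitAddCircle) p.2))
include hH

theorem contDiffAt_localHam {x p : M} (hp : p ∈ (chartAt E x).source) (θ : ℝ) :
    ContDiffAt ℝ ∞ (localHam H x) (θ, chart E x p) := by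
  have hp' : p ∈ (extChartAt 𝓘(ℝ, E) x).source := by rwa [extChartAt_source]
  have h1 : ContMDiffAt 𝓘(ℝ, ℝ × E) (𝓘(ℝ, ℝ).prod 𝓘(ℝ, E)) ∞
      (fun q : ℝ × E ↦ (q.1, (extChartAt 𝓘(ℝ, E) x).symm q.2)) (θ, chart E x p) := by
    refine ContMDiffAt.prodMk contDiffAt_fst.contMDiffAt ?_
    exact ContMDiffAt.comp (x := (θ, chart E x p)) (g := (extChartAt 𝓘(ℝ, E) x).symm)
      (f := Prod.snd) (contMDiffAt_chart_symm ((extChartAt 𝓘(ℝ, E) x).map_source hp'))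
      contDiffAt_snd.contMDiffAt
  exact ((hH _).comp _ h1).contDiffAt

omit hH [IsManifold 𝓘(ℝ, E) ∞ M] [NormedSpace ℝ V] in
theorem ham_comp_eventuallyEq {x : M} {g : V → M} {q : V} (hg : ContinuousAt g q)
    (hq : g q ∈ (chartAt E x).source) (r : V → ℝ) :
    (fun q ↦ H (r q : UnitAddCircle) (g q)) =ᶠ[𝓝 q]
      fun q ↦ localHam H x (r q, chart E x (g q)) := by
  filter_upwards [hg.preimage_mem_nhds ((chartAt E x).open_source.mem_nhds hq)] with q' hq'
  have hq'' : g q' ∈ (extChartAt 𝓘(ℝ, E) x).source := by rw [extChartAt_source]; exact hq'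
  simp only [localHam]
  rw [(extChartAt 𝓘(ℝ, E) x).left_inv hq'']

theorem hasFDerivAt_ham_comp {x : M} {g : V → M} {q : V} (hg : ContMDiffAt 𝓘(ℝ, V) 𝓘(ℝ, E) ∞ g q)
    (hq : g q ∈ (chartAt E x).source) {r : V → ℝ} {r' : V →L[ℝ] ℝ} (hr : HasFDerivAt r r' q) :
    HasFDerivAt (fun q ↦ H (r q : UnitAddCircle) (g q))
      ((fderiv ℝ (localHam H x) (r q, chart E x (g q))).comp
        (r'.prod (fderiv ℝ (fun q' ↦ chart E x (g q')) q))) q := by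
  refine HasFDerivAt.congr_of_eventuallyEq ?_ (ham_comp_eventuallyEq hg.continuousAt hq r)
  have hu := contDiffAt_chart_comp hg hq
  have h1 := ((contDiffAt_localHam hH hq (r q)).differentiableAt (by simp)).hasFDerivAt
  exact HasFDerivAt.comp q h1 (hr.prodMk (hu.differentiableAt (by simp)).hasFDerivAt)

theorem contDiffAt_ham_comp {g : V → M} {q : V} (hg : ContMDiffAt 𝓘(ℝ, V) 𝓘(ℝ, E) ∞ g q)
    {r : V → ℝ} (hr : ContDiffAt ℝ ∞ r q) :
    ContDiffAt ℝ ∞ (fun q ↦ H (r q : UnitAddCircle) (g q)) q := by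
  have hq := mem_chart_source E (g q)
  refine ContDiffAt.congr_of_eventuallyEq ?_ (ham_comp_eventuallyEq hg.continuousAt hq r)
  have hu := contDiffAt_chart_comp hg hq
  exact ContDiffAt.comp q (contDiffAt_localHam hH hq (r q)) (hr.prodMk hu)

theorem mvfderiv_ham (θ : ℝ) (x : M) (v : E) :
    mvfderiv 𝓘(ℝ, E) (H θ) x v = fderiv ℝ (localHam H x) (θ, chart E x x) (0, v) := by
  have hx := mem_chart_source E x
  have hH' : MDifferentiableAt 𝓘(ℝ, E) 𝓘(ℝ, ℝ) (H θ) x := by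
    have h2 : ContMDiff 𝓘(ℝ, E) (𝓘(ℝ, ℝ).prod 𝓘(ℝ, E)) ∞ (fun p : M ↦ (θ, p)) :=
      contMDiff_const.prodMk contMDiff_id
    exact (hH.comp h2).mdifferentiable (by simp) x
  have h3 : mfderiv 𝓘(ℝ, E) 𝓘(ℝ, ℝ) (H θ) x =
      fderiv ℝ (fun y ↦ localHam H x (θ, y)) (chart E x x) := by
    rw [hH'.mfderiv, modelWithCornersSelf_coe, range_id, fderivWithin_univ]
    rfl
  have h4 : HasFDerivAt (fun y ↦ localHam H x (θ, y)) _ (chart E x x) :=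
    HasFDerivAt.comp (chart E x x)
      ((contDiffAt_localHam hH hx θ).differentiableAt (by simp)).hasFDerivAt
      ((hasFDerivAt_const θ _).prodMk (hasFDerivAt_id _))
  have h5 : mvfderiv 𝓘(ℝ, E) (H θ) x v = (mfderiv 𝓘(ℝ, E) 𝓘(ℝ, ℝ) (H θ) x : E →L[ℝ] ℝ) v := rfl
  rw [h5, h3]
  exact (congrArg (fun A : E →L[ℝ] ℝ ↦ A v) h4.fderiv).trans (by simp)

end Local

/-! ### The first variation of the action -/

section Variation

variable {E : Type*} [NormedAddCommGroup E] [NormedSpace ℝ E]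
  {M : Type*} [TopologicalSpace M] [ChartedSpace E M] [IsManifold 𝓘(ℝ, E) ∞ M]

/-- The pull-back along a map of the plane is determined by the coordinate lines. -/
theorem pullForm_fst (σ : ExactSymplectic E M) {Γ : ℝ × ℝ → M}
    (hΓ : ContMDiff 𝓘(ℝ, ℝ × ℝ) 𝓘(ℝ, E) ∞ Γ) (s t : ℝ) :
    pullForm σ Γ (1, 0) (s, t) = pullForm σ (fun s ↦ Γ (s, t)) 1 s := by
  have h1 : HasMFDerivAt 𝓘(ℝ, ℝ) 𝓘(ℝ, ℝ × ℝ) (fun s : ℝ ↦ (s, t)) s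
      ((ContinuousLinearMap.id ℝ ℝ).prod (0 : ℝ →L[ℝ] ℝ)) :=
    ((hasFDerivAt_id s).prodMk (hasFDerivAt_const t s)).hasMFDerivAt
  have h2 := (HasMFDerivAt.comp s (hΓ.mdifferentiable (by simp) (s, t)).hasMFDerivAt h1).mfderiv
  have h3 := congrArg (fun A : ℝ →L[ℝ] E ↦ A 1) h2
  unfold pullForm
  refine congrArg (σ.form (Γ (s, t)) : E →L[ℝ] ℝ) (Eq.trans ?_ h3.symm)
  change (mfderiv 𝓘(ℝ, ℝ × ℝ) 𝓘(ℝ, E) Γ (s, t) : ℝ × ℝ →L[ℝ] E) (1, 0) =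
    (mfderiv 𝓘(ℝ, ℝ × ℝ) 𝓘(ℝ, E) Γ (s, t) : ℝ × ℝ →L[ℝ] E) (1, 0)
  rfl

theorem pullForm_snd (σ : ExactSymplectic E M) {Γ : ℝ × ℝ → M}
    (hΓ : ContMDiff 𝓘(ℝ, ℝ × ℝ) 𝓘(ℝ, E) ∞ Γ) (s t : ℝ) :
    pullForm σ Γ (0, 1) (s, t) = pullForm σ (fun t ↦ Γ (s, t)) 1 t := by
  have h1 : HasMFDerivAt 𝓘(ℝ, ℝ) 𝓘(ℝ, ℝ × ℝ) (fun t : ℝ ↦ (s, t)) t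
      ((0 : ℝ →L[ℝ] ℝ).prod (ContinuousLinearMap.id ℝ ℝ)) :=
    ((hasFDerivAt_const s t).prodMk (hasFDerivAt_id t)).hasMFDerivAt
  have h2 := (HasMFDerivAt.comp t (hΓ.mdifferentiable (by simp) (s, t)).hasMFDerivAt h1).mfderiv
  have h3 := congrArg (fun A : ℝ →L[ℝ] E ↦ A 1) h2
  unfold pullForm
  refine congrArg (σ.form (Γ (s, t)) : E →L[ℝ] ℝ) (Eq.trans ?_ h3.symm)
  change (mfderiv 𝓘(ℝ, ℝ × ℝ) 𝓘(ℝ, E) Γ (s, t) : ℝ × ℝ →L[ℝ] E) (0, 1) =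
    (mfderiv 𝓘(ℝ, ℝ × ℝ) 𝓘(ℝ, E) Γ (s, t) : ℝ × ℝ →L[ℝ] E) (0, 1)
  rfl

variable {H : UnitAddCircle → M → ℝ}
  (hH : ContMDiff (𝓘(ℝ, ℝ).prod 𝓘(ℝ, E)) 𝓘(ℝ, ℝ) ∞
    (fun p : ℝ × M ↦ H (p.1 : UnitAddCircle) p.2))
include hH

/-- The first variation formula for the action of a family of loops, where the Hamiltonian may be
shifted in time along the family. -/
theorem exists_first_variation (σ : ExactSymplectic E M) {Γ : ℝ × ℝ → M}
    (hΓ : ContMDiff 𝓘(ℝ, ℝ × ℝ) 𝓘(ℝ, E) ∞ Γ) (hper : ∀ s, Γ (s, 1) = Γ (s, 0))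
    {α : ℝ → ℝ} (hα : ContDiffAt ℝ ∞ α 0) :
    ∃ D : ℝ → ℝ, Continuous D ∧
      HasDerivAt (fun s ↦ (∫ t in (0 : ℝ)..1, pullForm σ Γ (0, 1) (s, t)) +
        ∫ t in (0 : ℝ)..1, H ((t - α s : ℝ) : UnitAddCircle) (Γ (s, t)))
        (∫ t in (0 : ℝ)..1, D t) 0 ∧
      ∀ (x : M) (t : ℝ), Γ (0, t) ∈ (chartAt E x).source →
        DifferentiableAt ℝ (localForm σ.form x) (chart E x (Γ (0, t))) →
        D t = fderiv ℝ (localForm σ.form x) (chart E x (Γ (0, t)))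
            (fderiv ℝ (fun q ↦ chart E x (Γ q)) (0, t) (1, 0))
            (fderiv ℝ (fun q ↦ chart E x (Γ q)) (0, t) (0, 1))
          - fderiv ℝ (localForm σ.form x) (chart E x (Γ (0, t)))
            (fderiv ℝ (fun q ↦ chart E x (Γ q)) (0, t) (0, 1))
            (fderiv ℝ (fun q ↦ chart E x (Γ q)) (0, t) (1, 0))
          + fderiv ℝ (localHam H x) (t - α 0, chart E x (Γ (0, t)))
            (0, fderiv ℝ (fun q ↦ chart E x (Γ q)) (0, t) (1, 0)
              + deriv α 0 • fderiv ℝ (fun q ↦ chart E x (Γ q)) (0, t) (0, 1)) := by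
  set P : ℝ × ℝ → ℝ := fun q ↦ H ((q.2 - α q.1 : ℝ) : UnitAddCircle) (Γ q) with hPdef
  -- `Q` freezes the delay. Its `t`-derivative contains the same time derivative of `H` that the
  -- moving delay produces in `∂_s P` with the factor `-α'(0)`.
  set Q : ℝ × ℝ → ℝ := fun q ↦ H ((q.2 - α 0 : ℝ) : UnitAddCircle) (Γ q) with hQdef
  have hα' (t : ℝ) : ContDiffAt ℝ ∞ (fun q : ℝ × ℝ ↦ q.2 - α q.1) (0, t) :=
    contDiffAt_snd.sub (ContDiffAt.comp (0, t) hα contDiffAt_fst)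
  have hP (t : ℝ) : ContDiffAt ℝ 1 P (0, t) :=
    (contDiffAt_ham_comp hH (hΓ (0, t)) (hα' t)).of_le (by simp)
  have hQ (q : ℝ × ℝ) : ContDiffAt ℝ 1 Q q :=
    (contDiffAt_ham_comp hH (hΓ q) (contDiffAt_snd.sub contDiffAt_const)).of_le (by simp)
  have hF (t : ℝ) := contDiffAt_pullForm σ hΓ (0, 1) (0, t)
  have hG (t : ℝ) := contDiffAt_pullForm σ hΓ (1, 0) (0, t)
  have hcont {f : ℝ × ℝ → ℝ} (hf : ∀ t, ContDiffAt ℝ 1 f (0, t)) (v : ℝ × ℝ) :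
      Continuous fun t : ℝ ↦ fderiv ℝ f (0, t) v := by
    refine Continuous.clm_apply (continuous_iff_continuousAt.2 fun t ↦ ?_) continuous_const
    have h := ((hf t).fderiv_right (m := 0) (by simp)).continuousAt
    exact ContinuousAt.comp (f := fun t : ℝ ↦ ((0 : ℝ), t)) h (by fun_prop)
  have cF := hcont hF (1, 0)
  have cP := hcont hP (1, 0)
  have cFP : Continuous fun t : ℝ ↦ fderiv ℝ (pullForm σ Γ (0, 1)) (0, t) (1, 0)
      + fderiv ℝ P (0, t) (1, 0) := cF.add cP
  have cG := hcont hG (0, 1)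
  have cQ := hcont (fun t ↦ hQ (0, t)) (0, 1)
  have hline (t : ℝ) : HasDerivAt (fun t : ℝ ↦ ((0 : ℝ), t)) ((0 : ℝ), (1 : ℝ)) t :=
    (hasDerivAt_const t (0 : ℝ)).prodMk (hasDerivAt_id t)
  -- Subtracting this total derivative turns `∂_s λ(∂_tΓ)` into `dλ(∂_sΓ, ∂_tΓ)` and trades the
  -- explicit time derivative of `H` for `α' dH(∂_tΓ)`. By periodicity in `t` its integral is zero.
  have hR (t : ℝ) : HasDerivAt (fun t : ℝ ↦ pullForm σ Γ (1, 0) (0, t) - deriv α 0 * Q (0, t))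
      (fderiv ℝ (pullForm σ Γ (1, 0)) (0, t) (0, 1) - deriv α 0 * fderiv ℝ Q (0, t) (0, 1)) t :=
    (((hG t).differentiableAt (by simp)).hasFDerivAt.comp_hasDerivAt t (hline t)).sub
      ((((hQ (0, t)).differentiableAt (by simp)).hasFDerivAt.comp_hasDerivAt t
        (hline t)).const_mul _)
  have cR : Continuous fun t : ℝ ↦ fderiv ℝ (pullForm σ Γ (1, 0)) (0, t) (0, 1)
      - deriv α 0 * fderiv ℝ Q (0, t) (0, 1) := cG.sub (continuous_const.mul cQ)
  have hzero : ∫ t in (0 : ℝ)..1, (fderiv ℝ (pullForm σ Γ (1, 0)) (0, t) (0, 1)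
      - deriv α 0 * fderiv ℝ Q (0, t) (0, 1)) = 0 := by
    rw [intervalIntegral.integral_eq_sub_of_hasDerivAt (fun t _ ↦ hR t) (cR.intervalIntegrable _ _)]
    have h1 : pullForm σ Γ (1, 0) (0, 1) = pullForm σ Γ (1, 0) (0, 0) := by
      rw [pullForm_fst σ hΓ, pullForm_fst σ hΓ]
      simp only [hper]
    have h2 : Q (0, 1) = Q (0, 0) := by
      have h3 : ((1 - α 0 : ℝ) : UnitAddCircle) = ((0 - α 0 : ℝ) : UnitAddCircle) := by
        rw [AddCircle.coe_sub, AddCircle.coe_sub, AddCircle.coe_period, AddCircle.coe_zero]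
      simp only [hQdef, hper, h3]
    rw [h1, h2, sub_self]
  refine ⟨fun t ↦ fderiv ℝ (pullForm σ Γ (0, 1)) (0, t) (1, 0) + fderiv ℝ P (0, t) (1, 0)
    - (fderiv ℝ (pullForm σ Γ (1, 0)) (0, t) (0, 1) - deriv α 0 * fderiv ℝ Q (0, t) (0, 1)),
    cFP.sub cR, ?_, ?_⟩
  · have h := (hasDerivAt_integral_of_contDiffAt hF).add (hasDerivAt_integral_of_contDiffAt hP)
    rw [intervalIntegral.integral_sub (cFP.intervalIntegrable _ _)
      (cR.intervalIntegrable _ _), hzero, sub_zero,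
      intervalIntegral.integral_add (cF.intervalIntegrable _ _) (cP.intervalIntegrable _ _)]
    exact h
  · intro x t hx hL
    have h1 := fderiv_pullForm_sub σ hΓ hx hL (1, 0) (0, 1)
    have hα1 : HasFDerivAt (fun q : ℝ × ℝ ↦ q.2 - α q.1)
        (ContinuousLinearMap.snd ℝ ℝ ℝ
          - deriv α 0 • ContinuousLinearMap.fst ℝ ℝ ℝ) (0, t) := by
      refine hasFDerivAt_snd.sub ?_
      exact ((hα.differentiableAt (by simp)).hasDerivAt).comp_hasFDerivAt ((0 : ℝ), t)
        hasFDerivAt_fst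
    have h2 := (hasFDerivAt_ham_comp hH (hΓ (0, t)) hx hα1).fderiv
    have hα2 : HasFDerivAt (fun q : ℝ × ℝ ↦ q.2 - α 0) (ContinuousLinearMap.snd ℝ ℝ ℝ) (0, t) :=
      hasFDerivAt_snd.sub_const _
    have h3 := (hasFDerivAt_ham_comp hH (hΓ (0, t)) hx hα2).fderiv
    rw [← h1]
    simp only [hPdef, hQdef]
    rw [h2, h3]
    simp only [ContinuousLinearMap.comp_apply, ContinuousLinearMap.prod_apply,
      sub_sub_eq_add_sub]
    have h4 (A : ℝ × E →L[ℝ] ℝ) (a : ℝ) (u v : E) :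
        A (-a, u) + a * A (1, v) = A (0, u + a • v) := by
      rw [← smul_eq_mul, ← map_smul, ← map_add]
      simp
    rw [← h4]
    simp
    ring

end Variation

/-- Cosine is strictly decreasing on `[0, π]` and the distance to the nearest integer is at most
`1/2`. Superlevel sets of a cosine thus serve as periodic neighbourhoods of a time. -/
theorem exists_int_abs_sub_lt {δ x : ℝ} (hδ : 0 ≤ δ) (hδ' : δ ≤ 1 / 2)
    (h : Real.cos (2 * Real.pi * δ) < Real.cos (2 * Real.pi * x)) : ∃ n : ℤ, |x - n| < δ := by
  refine ⟨round x, ?_⟩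
  have h1 : Real.cos (2 * Real.pi * x) = Real.cos (2 * Real.pi * |x - round x|) := by
    rw [← abs_of_pos Real.two_pi_pos, ← abs_mul, Real.cos_abs, abs_of_pos Real.two_pi_pos, mul_sub,
      mul_comm _ (round x : ℝ), Real.cos_sub_int_mul_two_pi]
  rw [h1] at h
  have h2 := abs_sub_round x
  have hpi := Real.pi_pos
  have h3 := (Real.strictAntiOn_cos.lt_iff_gt ⟨by positivity, by nlinarith⟩
    ⟨by positivity, by nlinarith⟩).1 h
  exact lt_of_mul_lt_mul_left h3 Real.two_pi_pos.le

/-! ### Existence and uniqueness of the Hamiltonian vector field -/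

section HamVec

variable {E : Type*} [NormedAddCommGroup E] [NormedSpace ℝ E]
  {M : Type*} [TopologicalSpace M] [ChartedSpace E M] [IsManifold 𝓘(ℝ, E) ∞ M]

theorem eq_of_extDerivOneForm_eq (σ : ExactSymplectic E M) (x : M) {X Y : E}
    (h : ∀ v : E, extDerivOneForm σ.form x X v = extDerivOneForm σ.form x Y v) : X = Y := by
  rw [← sub_eq_zero]
  refine σ.nondegenerate x (X - Y : E) fun v ↦ ?_
  have h1 := ((extDerivOneForm_eq σ.form x X v).symm.trans (h v)).trans
    (extDerivOneForm_eq σ.form x Y v)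
  have key (A : E →L[ℝ] E →L[ℝ] ℝ) (v : E) (hA : A X v - A v X = A Y v - A v Y) :
      A (X - Y) v - A v (X - Y) = 0 := by
    simp only [map_sub, _root_.sub_apply]
    linarith
  exact (extDerivOneForm_eq σ.form x _ v).trans (key _ v h1)

variable [FiniteDimensional ℝ E]

/-- Nondegeneracy makes `X ↦ ω(X, ·)` injective into the dual, which has the same finite dimension,
hence surjective. -/
theorem exists_extDerivOneForm_eq (σ : ExactSymplectic E M) (x : M) (A : E →L[ℝ] ℝ) :
    ∃ X : E, ∀ v : E, extDerivOneForm σ.form x X v = A v := by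
  set B := fderiv ℝ (localForm σ.form x) (chart E x x)
  set T : E →ₗ[ℝ] (E →L[ℝ] ℝ) := ((B - B.flip : E →L[ℝ] E →L[ℝ] ℝ) : E →ₗ[ℝ] (E →L[ℝ] ℝ))
  have hT (u v : E) : T u v = extDerivOneForm σ.form x u v :=
    (extDerivOneForm_eq σ.form x u v).symm
  have hinj : Function.Injective T := fun X Y hXY ↦
    eq_of_extDerivOneForm_eq σ x fun v ↦ by rw [← hT, ← hT, hXY]
  have hdim : Module.finrank ℝ E = Module.finrank ℝ (E →L[ℝ] ℝ) := by
    rw [← (LinearMap.toContinuousLinearMap (𝕜 := ℝ) (E := E) (F' := ℝ)).finrank_eq]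
    exact (Subspace.dual_finrank_eq (K := ℝ) (V := E)).symm
  obtain ⟨X, hX⟩ := (LinearMap.injective_iff_surjective_of_finrank_eq_finrank hdim).1 hinj A
  exact ⟨X, fun v ↦ by rw [← hT, hX]⟩

theorem extDerivOneForm_hamVec (σ : ExactSymplectic E M) (h : M → ℝ) (x : M)
    (v : TangentSpace 𝓘(ℝ, E) x) :
    extDerivOneForm σ.form x (hamVec σ h x) v = mvfderiv 𝓘(ℝ, E) h x v :=
  Classical.epsilon_spec
    (p := fun X : TangentSpace 𝓘(ℝ, E) x ↦
      ∀ v, extDerivOneForm σ.form x X v = mvfderiv 𝓘(ℝ, E) h x v)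
    (exists_extDerivOneForm_eq σ x (mvfderiv 𝓘(ℝ, E) h x)) v

theorem eq_hamVec_iff (σ : ExactSymplectic E M) (h : M → ℝ) (x : M) (X : E) :
    X = hamVec σ h x ↔ ∀ v : E, extDerivOneForm σ.form x X v = mvfderiv 𝓘(ℝ, E) h x v := by
  refine ⟨?_, fun hX ↦ ?_⟩
  · rintro rfl v
    exact extDerivOneForm_hamVec σ h x v
  · exact eq_of_extDerivOneForm_eq σ x fun v ↦ (hX v).trans (extDerivOneForm_hamVec σ h x v).symm

end HamVec

section Lines

variable {E : Type*} [NormedAddCommGroup E] [NormedSpace ℝ E] {g : ℝ × ℝ → E} {s t : ℝ}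

theorem hasDerivAt_line_fst (hg : DifferentiableAt ℝ g (s, t)) :
    HasDerivAt (fun s ↦ g (s, t)) (fderiv ℝ g (s, t) (1, 0)) s :=
  hg.hasFDerivAt.comp_hasDerivAt s ((hasDerivAt_id s).prodMk (hasDerivAt_const s t))

theorem hasDerivAt_line_snd (hg : DifferentiableAt ℝ g (s, t)) :
    HasDerivAt (fun t ↦ g (s, t)) (fderiv ℝ g (s, t) (0, 1)) t :=
  hg.hasFDerivAt.comp_hasDerivAt t ((hasDerivAt_const t s).prodMk (hasDerivAt_id t))

end Lines

section Loop

variable {E : Type*} [NormedAddCommGroup E] [NormedSpace ℝ E]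
  {M : Type*} [TopologicalSpace M] [ChartedSpace E M] [IsManifold 𝓘(ℝ, E) ∞ M]

theorem velocity_eq (γ : FreeLoop E M) (t : ℝ) :
    (γ.velocity t : E) = deriv (fun t' : ℝ ↦ chart E (γ t) (γ t')) t := by
  rw [← fderiv_apply_one_eq_deriv]
  exact mfderiv_eq_fderiv_chart (g := fun t : ℝ ↦ γ t) (γ.contMDiff.mdifferentiable (by simp) t) 1

end Loop

/-! ### Localized variations of a loop -/

section Loop

variable {E : Type*} [NormedAddCommGroup E] [NormedSpace ℝ E]
  {M : Type*} [TopologicalSpace M] [ChartedSpace E M] [IsManifold 𝓘(ℝ, E) ∞ M]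

/-- The bump variation of a loop inside a chart: a smooth function `Γ` of two variables, which is
periodic in the second one, equal to `g` for `s = 0` and outside of the support of the periodic bump
function `β`, and equal to `u + ε sin s β v` in the chart. -/
theorem exists_bump_variation {g : ℝ → M} (hg : ContMDiff 𝓘(ℝ, ℝ) 𝓘(ℝ, E) ∞ g)
    (hper : Function.Periodic g 1) (x : M) (v : E) {S : Set ℝ} {t₀ : ℝ} (hS : S ∈ 𝓝 t₀)
    (hSper : ∀ (t : ℝ) (n : ℤ), t ∈ S → t + n ∈ S)
    (hSsource : ∀ t ∈ S, g t ∈ (chartAt E x).source) {ρ : ℝ} (hρ : 0 < ρ)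
    (hStarget : ∀ t ∈ S, ∀ y, ‖y‖ ≤ ρ → chart E x (g t) + y ∈ (extChartAt 𝓘(ℝ, E) x).target) :
    ∃ (Γ : ℝ × ℝ → M) (β : ℝ → ℝ) (A : Set ℝ), ContMDiff 𝓘(ℝ, ℝ × ℝ) 𝓘(ℝ, E) ∞ Γ ∧
      (∀ s t, Γ (s, t + 1) = Γ (s, t)) ∧ (∀ t, Γ (0, t) = g t) ∧
      A ⊆ S ∧ (∀ n : ℤ, t₀ + n ∈ A) ∧ (∀ t, 0 ≤ β t) ∧ (∀ n : ℤ, 0 < β (t₀ + n)) ∧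
      (∀ s, ∀ t ∉ A, Γ (s, t) = g t) ∧
      (∀ s, ∀ t ∈ A, chart E x (Γ (s, t)) = chart E x (g t) + (Real.sin s * β t) • v) := by
  obtain ⟨δ', hδ'0, hδ'⟩ := Metric.mem_nhds_iff.1 hS
  set δ := min δ' (1 / 2) with hδ
  have hδ0 : 0 < δ := lt_min hδ'0 (by norm_num)
  have hδ2 : δ ≤ 1 / 2 := min_le_right _ _
  set C : ℝ → ℝ := fun t ↦ Real.cos (2 * Real.pi * (t - t₀)) with hC
  have hCc : ContDiff ℝ ∞ C := by
    rw [hC]; fun_prop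
  have hCper (t : ℝ) : C (t + 1) = C t := by
    simp only [hC]
    rw [← Real.cos_add_two_pi (2 * Real.pi * (t - t₀))]
    ring_nf
  have hCn (n : ℤ) : C (t₀ + n) = 1 := by
    simp only [hC, add_sub_cancel_left]
    rw [mul_comm, Real.cos_int_mul_two_pi]
  set k := Real.cos (2 * Real.pi * δ) with hk
  have hk1 : k < 1 := by
    have h := Real.strictAntiOn_cos (a := 0) (b := 2 * Real.pi * δ)
      ⟨le_rfl, Real.pi_pos.le⟩ ⟨by positivity, by nlinarith [Real.pi_pos]⟩ (by positivity)
    rwa [Real.cos_zero] at h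
  -- Two thresholds make the gluing smooth. The chart formula is used on `{k < C}`, while the bump
  -- vanishes on `{C ≤ κ}`. As `k < κ`, the open sets `{k < C}` and `{C < κ}` cover the line, and
  -- both descriptions agree on the overlap.
  set κ := (k + 1) / 2 with hκ
  have hkκ : k < κ := by linarith
  have hκ1 : κ < 1 := by linarith
  have hAS {t : ℝ} (ht : k < C t) : t ∈ S := by
    obtain ⟨n, hn⟩ := exists_int_abs_sub_lt hδ0.le hδ2 ht
    have h1 : t - n ∈ S := by
      apply hδ'
      rw [Metric.mem_ball, Real.dist_eq]
      refine lt_of_lt_of_le ?_ (min_le_left δ' (1 / 2))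
      rwa [show t - n - t₀ = t - t₀ - n by ring]
    simpa using hSper _ n h1
  -- With this scale the displacement has norm at most `ρ` for every `s`, since `|sin s| ≤ 1`;
  -- adding `1` allows `v = 0`. The sine keeps the family inside the chart for all real `s` and has
  -- derivative `1` at `0`.
  set ε := ρ / (‖v‖ + 1) with hε
  have hv1 : 0 < ‖v‖ + 1 := by positivity
  have hε0 : 0 < ε := by positivity
  set β : ℝ → ℝ := fun t ↦ ε * Real.smoothTransition (C t - κ) with hβ
  have hβc : ContDiff ℝ ∞ β :=
    contDiff_const.mul (Real.smoothTransition.contDiff.comp (hCc.sub contDiff_const))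
  have hβ0 (t : ℝ) : 0 ≤ β t := mul_nonneg hε0.le (Real.smoothTransition.nonneg _)
  have hβ1 (t : ℝ) : β t ≤ ε := mul_le_of_le_one_right hε0.le (Real.smoothTransition.le_one _)
  have hβκ {t : ℝ} (ht : C t ≤ κ) : β t = 0 := by
    simp only [hβ]
    rw [Real.smoothTransition.zero_of_nonpos (by linarith), mul_zero]
  have hsmall (s t : ℝ) : ‖(Real.sin s * β t) • v‖ ≤ ρ := by
    rw [norm_smul, norm_mul, Real.norm_eq_abs, Real.norm_eq_abs, abs_of_nonneg (hβ0 t)]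
    have h1 : |Real.sin s| * β t ≤ 1 * ε :=
      mul_le_mul (Real.abs_sin_le_one s) (hβ1 t) (hβ0 t) zero_le_one
    calc |Real.sin s| * β t * ‖v‖ ≤ ε * (‖v‖ + 1) := by
          rw [one_mul] at h1
          exact mul_le_mul h1 (by linarith) (norm_nonneg v) hε0.le
      _ = ρ := by rw [hε]; field_simp
  have hleft {t : ℝ} (ht : t ∈ S) : (extChartAt 𝓘(ℝ, E) x).symm (chart E x (g t)) = g t :=
    (extChartAt 𝓘(ℝ, E) x).left_inv (by rw [extChartAt_source]; exact hSsource t ht)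
  set Γ : ℝ × ℝ → M := fun q ↦ if k < C q.2 then
    (extChartAt 𝓘(ℝ, E) x).symm (chart E x (g q.2) + (Real.sin q.1 * β q.2) • v) else g q.2 with hΓ
  refine ⟨Γ, β, {t | k < C t}, ?_, ?_, ?_, fun t ht ↦ hAS ht, ?_, hβ0, ?_, ?_, ?_⟩
  · rintro ⟨s, t⟩
    have hCcont : Continuous fun q : ℝ × ℝ ↦ C q.2 := hCc.continuous.comp continuous_snd
    by_cases ht : k < C t
    · have hev : Γ =ᶠ[𝓝 (s, t)] fun q ↦ (extChartAt 𝓘(ℝ, E) x).symm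
          (chart E x (g q.2) + (Real.sin q.1 * β q.2) • v) := by
        filter_upwards [(isOpen_lt continuous_const hCcont).mem_nhds (show k < C (s, t).2 from ht)]
          with q hq
        exact if_pos hq
      refine ContMDiffAt.congr_of_eventuallyEq ?_ hev
      have h1 : ContDiffAt ℝ ∞ (fun t ↦ chart E x (g t)) t :=
        contDiffAt_chart_comp (hg t) (hSsource t (hAS ht))
      have h2 : ContDiffAt ℝ ∞ (fun q : ℝ × ℝ ↦
          chart E x (g q.2) + (Real.sin q.1 * β q.2) • v) (s, t) := by
        have h3 : ContDiffAt ℝ ∞ (fun q : ℝ × ℝ ↦ Real.sin q.1 * β q.2) (s, t) := (Real.contDiff_sin.contDiffAt.comp (s, t) contDiffAt_fst).mul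
          (hβc.contDiffAt.comp (s, t) contDiffAt_snd)
        exact (ContDiffAt.comp (s, t) h1 contDiffAt_snd).add (h3.smul contDiffAt_const)
      exact ContMDiffAt.comp (x := (s, t)) (g := (extChartAt 𝓘(ℝ, E) x).symm)
        (contMDiffAt_chart_symm (hStarget t (hAS ht) _ (hsmall s t))) h2.contMDiffAt
    · have hev : Γ =ᶠ[𝓝 (s, t)] fun q ↦ g q.2 := by
        filter_upwards [(isOpen_lt hCcont continuous_const).mem_nhds
          (show C (s, t).2 < κ by exact lt_of_le_of_lt (not_lt.1 ht) hkκ)] with q hq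
        simp only [hΓ]
        split_ifs with hq'
        · rw [hβκ (le_of_lt hq), mul_zero, zero_smul, add_zero, hleft (hAS hq')]
        · rfl
      refine ContMDiffAt.congr_of_eventuallyEq ?_ hev
      exact ContMDiffAt.comp (x := (s, t)) (g := g) (f := Prod.snd) (hg t)
        contDiffAt_snd.contMDiffAt
  · intro s t
    simp only [hΓ, hβ, hCper, hper t]
  · intro t
    simp only [hΓ, Real.sin_zero, zero_mul, zero_smul, add_zero]
    split_ifs with ht
    · exact hleft (hAS ht)
    · rfl
  · intro n
    simpa only [Set.mem_ofPred_eq, hCn] using hk1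
  · intro n
    simp only [hβ, hCn]
    exact mul_pos hε0 (Real.smoothTransition.pos_of_pos (by linarith))
  · intro s t ht
    exact if_neg ht
  · intro s t ht
    have h1 : Γ (s, t) = (extChartAt 𝓘(ℝ, E) x).symm
        (chart E x (g t) + (Real.sin s * β t) • v) := if_pos ht
    rw [h1]
    exact (extChartAt 𝓘(ℝ, E) x).right_inv (hStarget t (hAS ht) _ (hsmall s t))

end Loop

/-! ### The fundamental lemma of the calculus of variations -/

section Loop

variable {E : Type*} [NormedAddCommGroup E] [NormedSpace ℝ E]
  {M : Type*} [TopologicalSpace M] [ChartedSpace E M] [IsManifold 𝓘(ℝ, E) ∞ M]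

omit [IsManifold 𝓘(ℝ, E) ∞ M] in
theorem FreeLoop.periodic (γ : FreeLoop E M) : Function.Periodic (fun t : ℝ ↦ γ t) 1 := by
  intro t
  simp only [AddCircle.coe_add, AddCircle.coe_period, add_zero]

omit [IsManifold 𝓘(ℝ, E) ∞ M] in
theorem localHam_periodic (H : UnitAddCircle → M → ℝ) (x : M) (θ : ℝ) (y : E) :
    localHam H x (θ + 1, y) = localHam H x (θ, y) := by
  simp [localHam]

omit [IsManifold 𝓘(ℝ, E) ∞ M] in
theorem fderiv_localHam_periodic (H : UnitAddCircle → M → ℝ) (x : M) (θ : ℝ) (y : E) :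
    fderiv ℝ (localHam H x) (θ + 1, y) = fderiv ℝ (localHam H x) (θ, y) := by
  have h := fderiv_comp_add_right (𝕜 := ℝ) (f := localHam H x) (x := (θ, y)) ((1 : ℝ), (0 : E))
  have h1 : (fun q : ℝ × E ↦ localHam H x (q + (1, 0))) = localHam H x := by
    funext q
    have h2 : q + ((1 : ℝ), (0 : E)) = (q.1 + 1, q.2) := by ext <;> simp
    rw [h2, localHam_periodic]
  rw [h1] at h
  rw [h]
  simp

variable {H : UnitAddCircle → M → ℝ}
  (hH : ContMDiff (𝓘(ℝ, ℝ).prod 𝓘(ℝ, E)) 𝓘(ℝ, ℝ) ∞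
    (fun p : ℝ × M ↦ H (p.1 : UnitAddCircle) p.2))
include hH

/-- The density of the first variation of a loop `γ`, in the direction of a vector which is constant
in the preferred chart at `x`. -/
noncomputable def variationDensity (σ : ExactSymplectic E M) (H : UnitAddCircle → M → ℝ)
    (γ : FreeLoop E M) (r : ℝ) (x : M) (v : E) (t : ℝ) : ℝ :=
  fderiv ℝ (localForm σ.form x) (chart E x (γ t)) v (deriv (fun t : ℝ ↦ chart E x (γ t)) t)
    - fderiv ℝ (localForm σ.form x) (chart E x (γ t)) (deriv (fun t : ℝ ↦ chart E x (γ t)) t) v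
    + fderiv ℝ (localHam H x) (t - r, chart E x (γ t)) (0, v)

omit hH in
theorem variationDensity_periodic (σ : ExactSymplectic E M) (H : UnitAddCircle → M → ℝ)
    (γ : FreeLoop E M) (r : ℝ) (x : M) (v : E) :
    Function.Periodic (variationDensity σ H γ r x v) 1 := by
  intro t
  have h1 : γ ((t + 1 : ℝ) : UnitAddCircle) = γ t := γ.periodic t
  have h2 : deriv (fun t : ℝ ↦ chart E x (γ t)) (t + 1) = deriv (fun t : ℝ ↦ chart E x (γ t)) t := by
    rw [← deriv_comp_add_const]
    congr 1
    funext t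
    exact congrArg (chart E x) (γ.periodic t)
  simp only [variationDensity, h1, h2]
  rw [show t + 1 - r = t - r + 1 by ring, fderiv_localHam_periodic]

theorem continuousAt_variationDensity (σ : ExactSymplectic E M) (γ : FreeLoop E M) (r : ℝ)
    (v : E) (t : ℝ) : ContinuousAt (variationDensity σ H γ r (γ t) v) t := by
  have hx := mem_chart_source E (γ t)
  have hu := contDiffAt_chart_comp (γ.contMDiff t) hx
  have hu1 : ContinuousAt (deriv fun t' : ℝ ↦ chart E (γ t) (γ t')) t := by
    have h1 : ContinuousAt (fderiv ℝ fun t' : ℝ ↦ chart E (γ t) (γ t')) t :=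
      (hu.fderiv_right (m := 0) (by simp)).continuousAt
    exact h1.clm_apply continuousAt_const
  have hL : ContinuousAt (fun t' : ℝ ↦
      fderiv ℝ (localForm σ.form (γ t)) (chart E (γ t) (γ t'))) t :=
    ContinuousAt.comp (g := fderiv ℝ (localForm σ.form (γ t)))
      ((contDiffAt_localForm σ (γ t)).fderiv_right (m := 0) (by simp)).continuousAt hu.continuousAt
  have hh : ContinuousAt (fun t' : ℝ ↦
      fderiv ℝ (localHam H (γ t)) (t' - r, chart E (γ t) (γ t'))) t :=
    ContinuousAt.comp (g := fderiv ℝ (localHam H (γ t)))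
      ((contDiffAt_localHam hH hx (t - r)).fderiv_right (m := 0) (by simp)).continuousAt
      ((continuousAt_id.sub continuousAt_const).prodMk hu.continuousAt)
  exact (((hL.clm_apply continuousAt_const).clm_apply hu1).sub
    ((hL.clm_apply hu1).clm_apply continuousAt_const)).add (hh.clm_apply continuousAt_const)

/-- The fundamental lemma of the calculus of variations, for the action functional. -/
theorem variationDensity_eq_zero (σ : ExactSymplectic E M) (γ : FreeLoop E M) (r : ℝ)
    (hcrit : ∀ Γ : ℝ × ℝ → M, ContMDiff 𝓘(ℝ, ℝ × ℝ) 𝓘(ℝ, E) ∞ Γ →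
      (∀ s t, Γ (s, t + 1) = Γ (s, t)) → (∀ t : ℝ, Γ (0, t) = γ t) →
      HasDerivAt (fun s ↦ (∫ t in (0 : ℝ)..1, pullForm σ Γ (0, 1) (s, t)) +
        ∫ t in (0 : ℝ)..1, H ((t - r : ℝ) : UnitAddCircle) (Γ (s, t))) 0 0)
    (t₀ : ℝ) (v : E) : variationDensity σ H γ r (γ t₀) v t₀ = 0 := by
  by_contra hne
  set x := γ t₀ with hxdef
  set w := variationDensity σ H γ r x v with hw
  have hx : γ t₀ ∈ (chartAt E x).source := mem_chart_source E x
  have hu := contDiffAt_chart_comp (γ.contMDiff t₀) hx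
  have hwper := variationDensity_periodic σ H γ r x v
  obtain ⟨ρ, hρ, hball⟩ := Metric.nhds_basis_closedBall.mem_iff.1
    (extChartAt_target_mem_nhds (I := 𝓘(ℝ, E)) x)
  -- The last condition says that the density keeps its sign. The radius `ρ / 2` leaves another `ρ /
  -- 2` for the displacement inside the chart target.
  set S : Set ℝ := {t | γ t ∈ (chartAt E x).source ∧
    chart E x (γ t) ∈ Metric.ball (chart E x x) (ρ / 2) ∧
    DifferentiableAt ℝ (localForm σ.form x) (chart E x (γ t)) ∧ 0 < w t₀ * w t} with hSdef
  have hS : S ∈ 𝓝 t₀ := by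
    have h1 := γ.contMDiff.continuous.continuousAt.preimage_mem_nhds
      ((chartAt E x).open_source.mem_nhds hx)
    have h2 := hu.continuousAt.preimage_mem_nhds
      (Metric.ball_mem_nhds (chart E x (γ t₀)) (half_pos hρ))
    have h3 := hu.continuousAt.eventually (((contDiffAt_localForm σ x).of_le
      (m := 1) (by simp)).eventually (by simp))
    have h4 : ∀ᶠ t in 𝓝 t₀, 0 < w t₀ * w t :=
      (continuousAt_const.mul (continuousAt_variationDensity hH σ γ r v t₀)).eventually_const_lt
        (mul_self_pos.2 hne)
    filter_upwards [h1, h2, h3, h4] with t ht1 ht2 ht3 ht4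
    exact ⟨ht1, ht2, ht3.differentiableAt (by simp), ht4⟩
  have hγn (t : ℝ) (n : ℤ) : γ ((t + n : ℝ) : UnitAddCircle) = γ t := by
    simpa only [mul_one] using γ.periodic.int_mul n t
  have hwn (t : ℝ) (n : ℤ) : w (t + n) = w t := by
    simpa only [mul_one] using hwper.int_mul n t
  have hSper (t : ℝ) (n : ℤ) (ht : t ∈ S) : t + n ∈ S := by
    simpa only [hSdef, Set.mem_ofPred_eq, hγn, hwn] using ht
  obtain ⟨Γ, β, A, hΓ, hΓper, hΓ0, hAS, htA, hβ0, hβpos, hΓout, hΓin⟩ :=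
    exists_bump_variation γ.contMDiff γ.periodic x v hS hSper (fun t ht ↦ ht.1) (half_pos hρ)
      (fun t ht y hy ↦ hball (by
        rw [mem_closedBall_iff_norm]
        have h1 := mem_ball_iff_norm.1 ht.2.1
        calc ‖chart E x (γ t) + y - chart E x x‖ = ‖(chart E x (γ t) - chart E x x) + y‖ := by
              congr 1; abel
          _ ≤ ‖chart E x (γ t) - chart E x x‖ + ‖y‖ := norm_add_le _ _
          _ ≤ ρ := by linarith))
  obtain ⟨D, hDc, hDderiv, hD⟩ := exists_first_variation hH σ hΓ
    (fun s ↦ by simpa using hΓper s 0) (α := fun _ ↦ r) contDiffAt_const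
  have hD0 : ∫ t in (0 : ℝ)..1, D t = 0 := hDderiv.unique (hcrit Γ hΓ hΓper hΓ0)
  have hin {t : ℝ} (ht : t ∈ A) : D t = β t * w t := by
    have hts := hAS ht
    have hsrc : Γ (0, t) ∈ (chartAt E x).source := by rw [hΓ0]; exact hts.1
    have hd := (contDiffAt_chart_comp (hΓ (0, t)) hsrc).differentiableAt (by simp)
    have h1 : fderiv ℝ (fun q ↦ chart E x (Γ q)) (0, t) (1, 0) = β t • v := by
      refine (hasDerivAt_line_fst hd).unique ?_
      have h2 : HasDerivAt (fun s ↦ chart E x (γ t) + (Real.sin s * β t) • v)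
          ((Real.cos 0 * β t) • v) 0 :=
        (((Real.hasDerivAt_sin 0).mul_const (β t)).smul_const v).const_add _
      rw [Real.cos_zero, one_mul] at h2
      simpa only [hΓin _ t ht] using h2
    have h2 : fderiv ℝ (fun q ↦ chart E x (Γ q)) (0, t) (0, 1) =
        deriv (fun t : ℝ ↦ chart E x (γ t)) t := by
      rw [← (hasDerivAt_line_snd hd).deriv]
      simp only [hΓ0]
    have h3 := hD x t hsrc (by rw [hΓ0]; exact hts.2.2.1)
    rw [h1, h2, hΓ0, deriv_const, zero_smul, add_zero] at h3
    rw [h3, hw, variationDensity]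
    have h4 : ((0 : ℝ), β t • v) = β t • ((0 : ℝ), v) := by simp
    rw [h4, map_smul, map_smul, map_smul, _root_.smul_apply]
    simp only [smul_eq_mul]
    ring
  have hout {t : ℝ} (ht : t ∉ A) : D t = 0 := by
    have hsrc := mem_chart_source E (Γ (0, t))
    have hd := (contDiffAt_chart_comp (hΓ (0, t)) hsrc).differentiableAt (by simp)
    have h1 : fderiv ℝ (fun q ↦ chart E (Γ (0, t)) (Γ q)) (0, t) (1, 0) = 0 := by
      refine (hasDerivAt_line_fst hd).unique ?_
      simp only [hΓout _ t ht]
      exact hasDerivAt_const _ _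
    have h3 := hD (Γ (0, t)) t hsrc ((contDiffAt_localForm σ _).differentiableAt (by simp))
    rw [h1, deriv_const, zero_smul, add_zero] at h3
    rw [h3, ← Prod.zero_eq_mk]
    simp only [map_zero, _root_.zero_apply, sub_zero, add_zero]
  have hnonneg (t : ℝ) : 0 ≤ w t₀ * D t := by
    by_cases ht : t ∈ A
    · rw [hin ht, mul_left_comm]
      exact mul_nonneg (hβ0 t) (hAS ht).2.2.2.le
    · rw [hout ht, mul_zero]
  -- The integral runs over `[0, 1]`, so the point of positivity is translated there by an integer;
  -- this is why the bump is positive at every `t₀ + n`.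
  have hpos : 0 < w t₀ * D (Int.fract t₀) := by
    have h1 : Int.fract t₀ = t₀ + (-⌊t₀⌋ : ℤ) := by
      push_cast; rw [← sub_eq_add_neg]; rfl
    rw [h1, hin (htA _), mul_left_comm]
    exact mul_pos (hβpos _) (hAS (htA _)).2.2.2
  have h := intervalIntegral.integral_pos (f := fun t ↦ w t₀ * D t) zero_lt_one
    (continuous_const.mul hDc).continuousOn
    (fun t _ ↦ hnonneg t) ⟨_, ⟨Int.fract_nonneg t₀, (Int.fract_lt_one t₀).le⟩, hpos⟩
  rw [intervalIntegral.integral_const_mul, hD0, mul_zero] at h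
  exact lt_irrefl _ h

theorem velocity_eq_hamVec_of_critical [FiniteDimensional ℝ E] (σ : ExactSymplectic E M)
    (γ : FreeLoop E M) (r : ℝ)
    (hcrit : ∀ Γ : ℝ × ℝ → M, ContMDiff 𝓘(ℝ, ℝ × ℝ) 𝓘(ℝ, E) ∞ Γ →
      (∀ s t, Γ (s, t + 1) = Γ (s, t)) → (∀ t : ℝ, Γ (0, t) = γ t) →
      HasDerivAt (fun s ↦ (∫ t in (0 : ℝ)..1, pullForm σ Γ (0, 1) (s, t)) +
        ∫ t in (0 : ℝ)..1, H ((t - r : ℝ) : UnitAddCircle) (Γ (s, t))) 0 0)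
    (t : ℝ) : γ.velocity t = hamVec σ (H ((t - r : ℝ) : UnitAddCircle)) (γ t) := by
  refine (eq_hamVec_iff σ _ _ _).2 fun v ↦ ?_
  have h := variationDensity_eq_zero hH σ γ r hcrit t v
  rw [variationDensity, ← velocity_eq, ← mvfderiv_ham hH] at h
  refine (extDerivOneForm_eq σ.form (γ t) _ v).trans ?_
  linarith

end Loop

/-! ### Phases and moduli of the coordinates -/

section CircleArg

theorem norm_mul_toCircle_circleArg (z : ℂ) :
    (‖z‖ : ℂ) * (AddCircle.toCircle (circleArg z) : ℂ) = z := by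
  rw [circleArg, AddCircle.toCircle_apply_mk, Circle.coe_exp]
  have h : 2 * Real.pi / 1 * (Complex.arg z / (2 * Real.pi)) = Complex.arg z := by
    field_simp
  rw [h, Complex.norm_mul_exp_arg_mul_I]

theorem circleArg_eq_of_eq_mul {z : ℂ} {ρ : ℝ} {φ : UnitAddCircle} (hρ : 0 < ρ)
    (h : z = ρ * (AddCircle.toCircle φ : ℂ)) : circleArg z = φ := by
  have hn : ‖z‖ = ρ := by
    rw [h, norm_mul, Circle.norm_coe, mul_one, Complex.norm_of_nonneg hρ.le]
  have h1 := norm_mul_toCircle_circleArg z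
  rw [hn, h] at h1
  have h2 := mul_left_cancel₀ (Complex.ofReal_ne_zero.2 hρ.ne') h1
  rw [← h] at h2
  exact AddCircle.injective_toCircle one_ne_zero (Subtype.ext h2)

theorem circleArg_real_mul {r : ℝ} (hr : 0 < r) (z : ℂ) : circleArg (r * z) = circleArg z := by
  rw [circleArg, circleArg, Complex.arg_real_mul z hr]

theorem circleArg_mul {z w : ℂ} (hz : z ≠ 0) (hw : w ≠ 0) :
    circleArg (z * w) = circleArg z + circleArg w := by
  refine circleArg_eq_of_eq_mul (ρ := ‖z‖ * ‖w‖) (by positivity) ?_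
  rw [AddCircle.toCircle_add, Circle.coe_mul, Complex.ofReal_mul]
  nth_rw 1 [← norm_mul_toCircle_circleArg z, ← norm_mul_toCircle_circleArg w]
  ring

end CircleArg

theorem sum_norm_sq {N : ℕ} (z : CSphere N) : ∑ j, ‖(z : CSpace N) j‖ ^ 2 = 1 := by
  have h := EuclideanSpace.norm_sq_eq (z : CSpace N)
  rw [norm_eq_of_mem_sphere, one_pow] at h
  exact h.symm

theorem sphereLift_projFun {N : ℕ} (a : Fin (N + 1) → ℝ) (z : CSphere N) :
    sphereLift (projFun a) z = ∑ j, a j * ‖(z : CSpace N) j‖ ^ 2 := by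
  have h : sphereLift (projFun a) z =
      (∑ j, a j * ‖(z : CSpace N) j‖ ^ 2) / ‖(z : CSpace N)‖ ^ 2 := rfl
  rw [h, norm_eq_of_mem_sphere, one_pow, div_one]

/-! ### The action in terms of delayed Hamiltonians, and the Hofer bound -/

section Loop

variable {E : Type*} [NormedAddCommGroup E] [NormedSpace ℝ E]
  {M : Type*} [TopologicalSpace M] [ChartedSpace E M]

/-- The integral of a Hamiltonian, delayed by `φ`, along a loop. -/
noncomputable def loopHam (H : UnitAddCircle → M → ℝ) (γ : FreeLoop E M) (φ : UnitAddCircle) : ℝ :=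
  ∫ t in (0 : ℝ)..1, H ((t : UnitAddCircle) - φ) (γ t)

variable [IsManifold 𝓘(ℝ, E) ∞ M] {H : UnitAddCircle → M → ℝ}
  (hH : ContMDiff (𝓘(ℝ, ℝ).prod 𝓘(ℝ, E)) 𝓘(ℝ, ℝ) ∞
    (fun p : ℝ × M ↦ H (p.1 : UnitAddCircle) p.2))
include hH

omit [IsManifold 𝓘(ℝ, E) ∞ M] in
theorem continuous_ham_delay (γ : FreeLoop E M) (φ : UnitAddCircle) :
    Continuous fun t : ℝ ↦ H ((t : UnitAddCircle) - φ) (γ t) := by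
  induction φ using QuotientAddGroup.induction_on with
  | H r =>
    exact hH.continuous.comp ((continuous_id.sub continuous_const).prodMk γ.contMDiff.continuous)

theorem action_joinExtAdd (σ : ExactSymplectic E M) {N : ℕ} (a : Fin (N + 1) → ℝ)
    (γ : FreeLoop E M) (z : CSphere N) :
    action σ (joinExtAdd H (projFun a)) (γ, z) =
      -(∫ t in (0 : ℝ)..1, pullForm σ (fun t : ℝ ↦ γ t) 1 t) -
        ∑ j, ‖(z : CSpace N) j‖ ^ 2 * (loopHam H γ (circleArg ((z : CSpace N) j)) + a j) := by
  have hc (j : Fin (N + 1)) : Continuous fun t : ℝ ↦ ‖(z : CSpace N) j‖ ^ 2 *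
      H ((t : UnitAddCircle) - circleArg ((z : CSpace N) j)) (γ t) :=
    continuous_const.mul (continuous_ham_delay hH γ (circleArg ((z : CSpace N) j)))
  have h1 : ∫ t in (0 : ℝ)..1, joinExtAdd H (projFun a) (t : UnitAddCircle) (γ t) z =
      ∑ j, ‖(z : CSpace N) j‖ ^ 2 * (loopHam H γ (circleArg ((z : CSpace N) j)) + a j) := by
    simp only [joinExtAdd, joinExt, sphereLift_projFun]
    rw [intervalIntegral.integral_add
      ((continuous_finsetSum _ fun j _ ↦ hc j).intervalIntegrable _ _) intervalIntegrable_const,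
      intervalIntegral.integral_finsetSum fun j _ ↦ (hc j).intervalIntegrable _ _]
    simp only [intervalIntegral.integral_const_mul, intervalIntegral.integral_const, loopHam,
      mul_add, Finset.sum_add_distrib]
    simp [mul_comm]
  rw [← h1]
  rfl

omit [IsManifold 𝓘(ℝ, E) ∞ M] in
theorem continuous_ham_loop (γ : FreeLoop E M) (φ : UnitAddCircle) :
    Continuous fun θ : UnitAddCircle ↦ H (θ - φ) (γ θ) :=
  (QuotientAddGroup.isQuotientMap_mk _).continuous_iff.2 (continuous_ham_delay hH γ φ)

omit hH [IsManifold 𝓘(ℝ, E) ∞ M] in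
theorem loopHam_eq (γ : FreeLoop E M) (φ : UnitAddCircle) :
    loopHam H γ φ = ∫ θ : UnitAddCircle, H θ (γ (θ + φ)) := by
  have h := UnitAddCircle.intervalIntegral_preimage 0 (fun θ : UnitAddCircle ↦ H (θ - φ) (γ θ))
  rw [zero_add] at h
  rw [loopHam, h, ← integral_add_right_eq_self _ φ]
  simp only [add_sub_cancel_right]

/-- After the translation `loopHam_eq` both integrands evaluate `H` at the same time `θ`, at two
points of `K`. Their difference is at most the oscillation of `H` over `K` at that time. -/
theorem ofReal_loopHam_sub_le (γ : FreeLoop E M) {K : Set M} (hK : ∀ θ, γ θ ∈ K)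
    (φ ψ : UnitAddCircle) :
    ENNReal.ofReal (loopHam H γ φ - loopHam H γ ψ) ≤ hoferNormOn K H := by
  have hc (φ : UnitAddCircle) : Continuous fun θ : UnitAddCircle ↦ H θ (γ (θ + φ)) := by
    have h := (continuous_ham_loop hH γ φ).comp (continuous_add_const φ)
    simpa only [Function.comp_def, add_sub_cancel_right] using h
  have hi {f : UnitAddCircle → ℝ} (hf : Continuous f) : Integrable f :=
    hf.integrable_of_hasCompactSupport (HasCompactSupport.of_compactSpace f)
  rw [loopHam_eq, loopHam_eq, ← integral_sub (hi (hc φ)) (hi (hc ψ))]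
  -- Truncation at `0` makes the integrand nonnegative, as needed to pass to the extended integral.
  have hmax := (((hc φ).sub (hc ψ)).max continuous_const : Continuous fun θ ↦
    max (H θ (γ (θ + φ)) - H θ (γ (θ + ψ))) 0)
  calc ENNReal.ofReal (∫ θ : UnitAddCircle, (H θ (γ (θ + φ)) - H θ (γ (θ + ψ))))
      ≤ ENNReal.ofReal (∫ θ : UnitAddCircle, max (H θ (γ (θ + φ)) - H θ (γ (θ + ψ))) 0) :=
        ENNReal.ofReal_le_ofReal (integral_mono (hi ((hc φ).sub (hc ψ))) (hi hmax)
          fun θ ↦ le_max_left _ _)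
    _ = ∫⁻ θ : UnitAddCircle,
          ENNReal.ofReal (max (H θ (γ (θ + φ)) - H θ (γ (θ + ψ))) 0) :=
        ofReal_integral_eq_lintegral_ofReal (hi hmax)
          (Eventually.of_forall fun θ ↦ le_max_right _ _)
    _ ≤ hoferNormOn K H := by
        refine lintegral_mono fun θ ↦ ?_
        rw [ENNReal.ofReal_max, ENNReal.ofReal_zero, max_eq_left zero_le,
          ← EReal.real_coe_toENNReal, EReal.coe_sub]
        exact EReal.toENNReal_le_toENNReal (EReal.sub_le_sub
          (le_iSup₂ (f := fun x (_ : x ∈ K) ↦ (H θ x : EReal)) _ (hK _))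
          (iInf₂_le (f := fun x (_ : x ∈ K) ↦ (H θ x : EReal)) _ (hK _)))

end Loop

/-! ### Curves in the sphere that change one modulus -/

section Rescale

variable {N : ℕ} (z : CSphere N) (j : Fin (N + 1))

/-- This is the squared norm of `z` after its `j`-th coordinate is multiplied by `exp s`, that is
`(1 - |z_j|²) + exp(s)² |z_j|²`. -/
theorem rescale_pos (s : ℝ) : 0 < 1 + (Real.exp s ^ 2 - 1) * ‖(z : CSpace N) j‖ ^ 2 := by
  have h1 : ‖(z : CSpace N) j‖ ^ 2 ≤ 1 :=
    (Finset.single_le_sum (f := fun i ↦ ‖(z : CSpace N) i‖ ^ 2)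
      (fun i _ ↦ sq_nonneg _) (Finset.mem_univ j)).trans_eq (sum_norm_sq z)
  have h2 : 0 < Real.exp s ^ 2 := by positivity
  by_cases h : ‖(z : CSpace N) j‖ ^ 2 = 0
  · rw [h]; norm_num
  · have h3 : 0 < ‖(z : CSpace N) j‖ ^ 2 := by positivity
    nlinarith [mul_pos h2 h3]

/-- The real factor of the `i`-th coordinate when the `j`-th coordinate of `z` is multiplied
by `exp s` and the result is normalized. -/
noncomputable def rescaleFactor (s : ℝ) (i : Fin (N + 1)) : ℝ :=
  (if i = j then Real.exp s else 1) / √(1 + (Real.exp s ^ 2 - 1) * ‖(z : CSpace N) j‖ ^ 2)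

theorem rescaleFactor_pos (s : ℝ) (i : Fin (N + 1)) : 0 < rescaleFactor z j s i := by
  refine div_pos ?_ (Real.sqrt_pos.2 (rescale_pos z j s))
  split_ifs <;> positivity

theorem sum_rescaleFactor_sq (s : ℝ) (b : Fin (N + 1) → ℝ) :
    ∑ i, (rescaleFactor z j s i) ^ 2 * ‖(z : CSpace N) i‖ ^ 2 * b i =
      (∑ i, ‖(z : CSpace N) i‖ ^ 2 * b i +
        (Real.exp s ^ 2 - 1) * (‖(z : CSpace N) j‖ ^ 2 * b j)) /
      (1 + (Real.exp s ^ 2 - 1) * ‖(z : CSpace N) j‖ ^ 2) := by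
  have h (i : Fin (N + 1)) : (rescaleFactor z j s i) ^ 2 * ‖(z : CSpace N) i‖ ^ 2 * b i =
      (‖(z : CSpace N) i‖ ^ 2 * b i +
        if i = j then (Real.exp s ^ 2 - 1) * (‖(z : CSpace N) j‖ ^ 2 * b j) else 0) /
      (1 + (Real.exp s ^ 2 - 1) * ‖(z : CSpace N) j‖ ^ 2) := by
    rw [rescaleFactor, div_pow, Real.sq_sqrt (rescale_pos z j s).le]
    split_ifs with hij
    · subst hij; ring
    · ring
  rw [Finset.sum_congr rfl fun i _ ↦ h i, ← Finset.sum_div, Finset.sum_add_distrib]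
  simp

/-- The curve in the sphere obtained by scaling the `j`-th coordinate and normalizing. -/
noncomputable def rescale (s : ℝ) : CSphere N :=
  ⟨WithLp.toLp 2 fun i ↦ (rescaleFactor z j s i : ℂ) * (z : CSpace N) i, by
    rw [mem_sphere_zero_iff_norm, EuclideanSpace.norm_eq, Real.sqrt_eq_one]
    have h := sum_rescaleFactor_sq z j s fun _ ↦ 1
    simp only [mul_one, sum_norm_sq] at h
    rw [div_self (rescale_pos z j s).ne'] at h
    refine (Finset.sum_congr rfl fun i _ ↦ ?_).trans h
    rw [norm_mul, mul_pow, Complex.norm_of_nonneg (rescaleFactor_pos z j s i).le]⟩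

theorem rescale_apply (s : ℝ) (i : Fin (N + 1)) :
    (rescale z j s : CSpace N) i = (rescaleFactor z j s i : ℂ) * (z : CSpace N) i := rfl

theorem rescale_zero : rescale z j 0 = z := by
  refine Subtype.ext (PiLp.ext fun i ↦ ?_)
  rw [rescale_apply, rescaleFactor]
  simp

theorem contDiff_rescale : ContDiff ℝ ∞ fun s ↦ (rescale z j s : CSpace N) := by
  refine (contDiff_piLp 2).2 fun i ↦ ?_
  simp only [rescale_apply]
  refine ContDiff.mul (Complex.ofRealCLM.contDiff.comp ?_) contDiff_const
  refine ContDiff.div ?_ (ContDiff.sqrt ?_ fun s ↦ (rescale_pos z j s).ne')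
    fun s ↦ (Real.sqrt_pos.2 (rescale_pos z j s)).ne'
  · split_ifs
    · exact Real.contDiff_exp
    · exact contDiff_const
  · exact contDiff_const.add (((Real.contDiff_exp.pow 2).sub contDiff_const).mul contDiff_const)

end Rescale

/-- The product is `O(s²)`. No continuity of `b` is required, which matters because the phase of a
coordinate may jump where the coordinate vanishes. -/
theorem hasDerivAt_norm_sq_mul {ζ : ℝ → ℂ} (hζ : DifferentiableAt ℝ ζ 0) (h0 : ζ 0 = 0)
    {b : ℝ → ℝ} {C : ℝ} (hb : ∀ᶠ s in 𝓝 0, |b s| ≤ C) :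
    HasDerivAt (fun s ↦ ‖ζ s‖ ^ 2 * b s) 0 0 := by
  have h1 : ζ =O[𝓝 0] fun s : ℝ ↦ s := by
    simpa [h0] using hζ.isBigO_sub
  have h2 : (fun s ↦ ‖ζ s‖ ^ 2 * b s) =O[𝓝 0] fun s : ℝ ↦ s ^ 2 := by
    have h3 : b =O[𝓝 0] fun _ ↦ (1 : ℝ) :=
      Asymptotics.IsBigO.of_bound C (by simpa using hb)
    simpa using (h1.norm_left.pow 2).mul h3
  rw [hasDerivAt_iff_isLittleO_nhds_zero]
  simp only [zero_add, h0, norm_zero, smul_zero, sub_zero]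
  have h4 : (fun s : ℝ ↦ s ^ 2) =o[𝓝 0] fun s : ℝ ↦ s := by
    simpa using Asymptotics.isLittleO_pow_pow (𝕜 := ℝ) (one_lt_two)
  simpa using h2.trans_isLittleO h4

/-! ### Necessary conditions at a critical point -/

section Loop

variable {E : Type*} [NormedAddCommGroup E] [NormedSpace ℝ E]
  {M : Type*} [TopologicalSpace M] [ChartedSpace E M] [IsManifold 𝓘(ℝ, E) ∞ M]

theorem rotate_velocity (γ : FreeLoop E M) (r t : ℝ) :
    ((γ.rotate (r : UnitAddCircle)).velocity t : E) = γ.velocity (t - r) := by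
  rw [velocity_eq, velocity_eq]
  exact deriv_comp_sub_const
    (f := fun t' : ℝ ↦ chart E (γ ((t - r : ℝ) : UnitAddCircle)) (γ (t' : UnitAddCircle))) r t

omit [IsManifold 𝓘(ℝ, E) ∞ M] in
theorem rotate_rotate_neg (γ : FreeLoop E M) (φ : UnitAddCircle) :
    (γ.rotate (-φ)).rotate φ = γ := by
  cases γ
  simp [FreeLoop.rotate]

variable {H : UnitAddCircle → M → ℝ}
  (hH : ContMDiff (𝓘(ℝ, ℝ).prod 𝓘(ℝ, E)) 𝓘(ℝ, ℝ) ∞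
    (fun p : ℝ × M ↦ H (p.1 : UnitAddCircle) p.2))
include hH

/-- The Lagrange multiplier condition at a critical point. -/
theorem weight_eq_of_mem_Crit (σ : ExactSymplectic E M) {N : ℕ} (a : Fin (N + 1) → ℝ)
    {γ : FreeLoop E M} {z : CSphere N} (h : (γ, z) ∈ Crit (action σ (joinExtAdd H (projFun a))))
    {j : Fin (N + 1)} (hj : (z : CSpace N) j ≠ 0) :
    loopHam H γ (circleArg ((z : CSpace N) j)) + a j =
      ∑ i, ‖(z : CSpace N) i‖ ^ 2 * (loopHam H γ (circleArg ((z : CSpace N) i)) + a i) := by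
  set b : Fin (N + 1) → ℝ := fun i ↦ loopHam H γ (circleArg ((z : CSpace N) i)) + a i with hb
  -- All coordinates are multiplied by positive reals, so the phases, and with them the values `b
  -- i`, stay constant along the family.
  have hfam : IsSmoothFamily fun s ↦ (γ, rescale z j s) :=
    ⟨γ.contMDiff.comp (contDiff_snd.contMDiff), contDiff_rescale z j⟩
  have h1 := h _ hfam (by simp only [rescale_zero])
  have hval (s : ℝ) : action σ (joinExtAdd H (projFun a)) (γ, rescale z j s) =
      -(∫ t in (0 : ℝ)..1, pullForm σ (fun t : ℝ ↦ γ t) 1 t) -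
      (∑ i, ‖(z : CSpace N) i‖ ^ 2 * b i +
        (Real.exp s ^ 2 - 1) * (‖(z : CSpace N) j‖ ^ 2 * b j)) /
      (1 + (Real.exp s ^ 2 - 1) * ‖(z : CSpace N) j‖ ^ 2) := by
    rw [action_joinExtAdd hH, ← sum_rescaleFactor_sq]
    congr 1
    refine Finset.sum_congr rfl fun i _ ↦ ?_
    rw [rescale_apply, circleArg_real_mul (rescaleFactor_pos z j s i), norm_mul, mul_pow,
      Complex.norm_of_nonneg (rescaleFactor_pos z j s i).le]
  simp only [hval] at h1
  have he : HasDerivAt (fun s : ℝ ↦ Real.exp s ^ 2 - 1) 2 0 := by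
    simpa using ((Real.hasDerivAt_exp 0).pow 2).sub_const 1
  have hq : 1 + (Real.exp 0 ^ 2 - 1) * ‖(z : CSpace N) j‖ ^ 2 ≠ 0 := (rescale_pos z j 0).ne'
  -- The denominator is `1` at `s = 0`, so the derivative of the quotient is `2 |z_j|² (b_j - ∑
  -- |z_i|² b_i)`.
  have h2 := ((((he.mul_const (‖(z : CSpace N) j‖ ^ 2 * b j)).const_add
    (∑ i, ‖(z : CSpace N) i‖ ^ 2 * b i)).div
    ((he.mul_const (‖(z : CSpace N) j‖ ^ 2)).const_add 1) hq).const_sub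
    (-(∫ t in (0 : ℝ)..1, pullForm σ (fun t : ℝ ↦ γ t) 1 t))).unique h1
  simp at h2
  have h3 : 0 < ‖(z : CSpace N) j‖ := norm_pos_iff.2 hj
  have h4 : ‖(z : CSpace N) j‖ ^ 2 * (b j - ∑ i, ‖(z : CSpace N) i‖ ^ 2 * b i) = 0 := by
    linarith
  have h5 := (mul_eq_zero.1 h4).resolve_left (by positivity)
  linarith

/-- If the increments of the weights exceed the Hofer norm, a critical point has a single nonzero
coordinate. -/
theorem eq_of_coord_ne_zero (σ : ExactSymplectic E M) {N : ℕ} (a : Fin (N + 1) → ℝ)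
    {γ : FreeLoop E M} {z : CSphere N} (h : (γ, z) ∈ Crit (action σ (joinExtAdd H (projFun a))))
    {K : Set M} (hK : ∀ θ, γ θ ∈ K)
    (ha : ∀ j : Fin N, hoferNormOn K H < ENNReal.ofReal (a j.succ - a j.castSucc))
    {j k : Fin (N + 1)} (hj : (z : CSpace N) j ≠ 0) (hk : (z : CSpace N) k ≠ 0) : j = k := by
  wlog hjk : j < k generalizing j k
  · rcases lt_trichotomy j k with h1 | h1 | h1
    · exact this hj hk h1
    · exact h1
    · exact (this hk hj h1).symm
  exfalso
  have hmono : StrictMono a := Fin.strictMono_iff_lt_succ.2 fun i ↦ by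
    have h1 := ENNReal.ofReal_pos.1 (lt_of_le_of_lt zero_le (ha i))
    linarith
  -- As `j < k`, the index `j` has a successor, and monotonicity of the weights reduces the gap `a k
  -- - a j` to a single increment.
  obtain ⟨i, rfl⟩ : ∃ i : Fin N, i.castSucc = j :=
    ⟨j.castPred (hjk.trans_le (Fin.le_last k)).ne, Fin.castSucc_castPred _ _⟩
  have h1 : a i.succ ≤ a k := hmono.monotone (Fin.castSucc_lt_iff_succ_le.1 hjk)
  have h2 := (weight_eq_of_mem_Crit hH σ a h hj).trans (weight_eq_of_mem_Crit hH σ a h hk).symm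
  have h3 := ofReal_loopHam_sub_le hH γ hK (circleArg ((z : CSpace N) i.castSucc))
    (circleArg ((z : CSpace N) k))
  refine absurd (h3.trans_lt (ha i)) (not_lt.2 (ENNReal.ofReal_le_ofReal ?_))
  linarith

/-- With `z` fixed and one nonzero coordinate, the action is, up to a constant, the action of the
Hamiltonian delayed by the phase `r`; only families of loops are needed. -/
theorem velocity_eq_of_mem_Crit [FiniteDimensional ℝ E] (σ : ExactSymplectic E M) {N : ℕ}
    (a : Fin (N + 1) → ℝ) {γ : FreeLoop E M} {z : CSphere N}
    (h : (γ, z) ∈ Crit (action σ (joinExtAdd H (projFun a)))) {j : Fin (N + 1)}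
    (hj : ∀ i, i ≠ j → (z : CSpace N) i = 0) {r : ℝ}
    (hr : circleArg ((z : CSpace N) j) = (r : UnitAddCircle)) (t : ℝ) :
    γ.velocity t = hamVec σ (H ((t - r : ℝ) : UnitAddCircle)) (γ t) := by
  refine velocity_eq_hamVec_of_critical hH σ γ r (fun Γ hΓ hΓper hΓ0 ↦ ?_) t
  have hper (s : ℝ) : Function.Periodic (fun t ↦ Γ (s, t)) 1 := hΓper s
  set c : ℝ → FreeLoop E M × CSphere N := fun s ↦
    (⟨(hper s).lift, by
      have h1 : ContMDiff 𝓘(ℝ, ℝ) 𝓘(ℝ, E) ∞ fun t : ℝ ↦ Γ (s, t) :=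
        hΓ.comp (contDiff_const.prodMk contDiff_id).contMDiff
      exact h1⟩, z) with hc
  have hfam : IsSmoothFamily c := ⟨hΓ, (contDiff_const : ContDiff ℝ ∞ fun _ : ℝ ↦ (z : CSpace N))⟩
  have hc0 : c 0 = (γ, z) := by
    have h2 : (hper 0).lift = γ.toFun := by
      funext θ
      induction θ using QuotientAddGroup.induction_on with
      | H t => exact hΓ0 t
    simp only [hc, h2]
  have h1 := h c hfam hc0
  have hval (s : ℝ) : action σ (joinExtAdd H (projFun a)) (c s) =
      -((∫ t in (0 : ℝ)..1, pullForm σ Γ (0, 1) (s, t)) +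
        ∫ t in (0 : ℝ)..1, H ((t - r : ℝ) : UnitAddCircle) (Γ (s, t))) -
        ‖(z : CSpace N) j‖ ^ 2 * a j := by
    have hz : ‖(z : CSpace N) j‖ ^ 2 = 1 :=
      (Finset.sum_eq_single j (fun i _ hi ↦ by simp [hj i hi]) (by simp)).symm.trans
        (sum_norm_sq z)
    have h3 := action_joinExtAdd hH σ a (c s).1 z
    rw [Finset.sum_eq_single j (fun i _ hi ↦ by simp [hj i hi]) (by simp), hr, hz, one_mul] at h3
    refine h3.trans ?_
    simp only [pullForm_snd σ hΓ]
    rw [hz, one_mul, neg_add, sub_add_eq_sub_sub, ← sub_eq_add_neg]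
    rfl
  simp only [hval] at h1
  have h4 := (h1.add_const (‖(z : CSpace N) j‖ ^ 2 * a j)).neg
  rw [neg_zero] at h4
  refine h4.congr_of_eventuallyEq (Eventually.of_forall fun s ↦ ?_)
  simp only [Pi.neg_apply, sub_add_cancel, neg_neg]

end Loop

/-! ### Sufficiency: delayed orbits are critical -/

section Loop

variable {E : Type*} [NormedAddCommGroup E] [NormedSpace ℝ E]
  {M : Type*} [TopologicalSpace M] [ChartedSpace E M] [IsManifold 𝓘(ℝ, E) ∞ M]

/-- A smooth curve in `ℂ` has a smooth argument near a point where it does not vanish. -/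
theorem exists_smooth_circleArg {ζ : ℝ → ℂ} (hζ : ContDiff ℝ ∞ ζ) (h0 : ζ 0 ≠ 0) {r : ℝ}
    (hr : circleArg (ζ 0) = (r : UnitAddCircle)) :
    ∃ α : ℝ → ℝ, ContDiffAt ℝ ∞ α 0 ∧ α 0 = r ∧
      ∀ᶠ s in 𝓝 0, circleArg (ζ s) = (α s : UnitAddCircle) := by
  -- Dividing by `ζ 0` moves the curve near `1`, away from the branch cut of the logarithm.
  refine ⟨fun s ↦ r + (Complex.log (ζ s / ζ 0)).im / (2 * Real.pi), ?_, ?_, ?_⟩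
  · have h1 : ContDiffAt ℝ ∞ Complex.log (ζ 0 / ζ 0) := by
      rw [div_self h0]
      exact (Complex.contDiffAt_log Complex.one_mem_slitPlane).restrict_scalars ℝ
    have h2 : ContDiffAt ℝ ∞ (fun s ↦ Complex.log (ζ s / ζ 0)) 0 :=
      ContDiffAt.comp (g := Complex.log) (f := fun s ↦ ζ s / ζ 0) 0 h1 (hζ.contDiffAt.div_const _)
    exact contDiffAt_const.add ((Complex.imCLM.contDiff.contDiffAt.comp 0 h2).div_const _)
  · simp [div_self h0]
  · filter_upwards [hζ.continuous.continuousAt.eventually_ne h0] with s hs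
    have h3 : ζ s = ζ 0 * (ζ s / ζ 0) := by field_simp
    conv_lhs => rw [h3]
    rw [circleArg_mul h0 (div_ne_zero hs h0), hr, Complex.log_im, AddCircle.coe_add]
    rfl

variable {H : UnitAddCircle → M → ℝ}
  (hH : ContMDiff (𝓘(ℝ, ℝ).prod 𝓘(ℝ, E)) 𝓘(ℝ, ℝ) ∞
    (fun p : ℝ × M ↦ H (p.1 : UnitAddCircle) p.2))
include hH

-- The bound is uniform in `φ` because the phases of the coordinates vanishing at `s = 0` are
-- uncontrolled; it follows from compactness of the circle.
omit [IsManifold 𝓘(ℝ, E) ∞ M] in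
theorem exists_loopHam_bound {c : ℝ → FreeLoop E M}
    (hc : ContMDiff 𝓘(ℝ, ℝ × ℝ) 𝓘(ℝ, E) ∞ (fun q : ℝ × ℝ ↦ (c q.1) (q.2 : UnitAddCircle))) :
    ∃ C, ∀ᶠ s in 𝓝 (0 : ℝ), ∀ φ, |loopHam H (c s) φ| ≤ C := by
  have hcont : Continuous fun q : ℝ × ℝ × ℝ ↦
      H ((q.2.1 - q.2.2 : ℝ) : UnitAddCircle) (c q.1 (q.2.1 : UnitAddCircle)) :=
    hH.continuous.comp (((continuous_fst.comp continuous_snd).sub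
      (continuous_snd.comp continuous_snd)).prodMk
      (hc.continuous.comp (continuous_fst.prodMk (continuous_fst.comp continuous_snd))))
  obtain ⟨C, hC⟩ := ((isCompact_Icc (a := (-1 : ℝ)) (b := 1)).prod
    ((isCompact_Icc (a := (0 : ℝ)) (b := 1)).prod
      (isCompact_Icc (a := (0 : ℝ)) (b := 1)))).exists_bound_of_continuousOn hcont.continuousOn
  refine ⟨C, ?_⟩
  filter_upwards [Icc_mem_nhds (show (-1 : ℝ) < 0 by norm_num) zero_lt_one] with s hs φ
  obtain ⟨r, hr, rfl⟩ : ∃ r ∈ Icc (0 : ℝ) 1, (r : UnitAddCircle) = φ := by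
    obtain ⟨r, hr, h⟩ := AddCircle.eq_coe_Ico φ
    exact ⟨r, Ico_subset_Icc_self hr, h⟩
  have h := intervalIntegral.norm_integral_le_of_norm_le_const (a := 0) (b := 1)
    (f := fun t : ℝ ↦ H ((t : UnitAddCircle) - (r : UnitAddCircle)) (c s t)) (C := C)
    fun t ht ↦ by
      rw [uIoc_of_le zero_le_one] at ht
      exact hC (s, t, r) ⟨hs, Ioc_subset_Icc_self ht, hr⟩
  simpa [loopHam] using h

theorem mem_Crit_of_velocity_eq [FiniteDimensional ℝ E] (σ : ExactSymplectic E M) {N : ℕ}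
    (a : Fin (N + 1) → ℝ) {γ : FreeLoop E M} {z : CSphere N} {j : Fin (N + 1)}
    (hj : ∀ i, i ≠ j → (z : CSpace N) i = 0) (hj0 : (z : CSpace N) j ≠ 0) {r : ℝ}
    (hr : circleArg ((z : CSpace N) j) = (r : UnitAddCircle))
    (hγ : ∀ t : ℝ, γ.velocity t = hamVec σ (H ((t - r : ℝ) : UnitAddCircle)) (γ t)) :
    (γ, z) ∈ Crit (action σ (joinExtAdd H (projFun a))) := by
  intro c hc hc0
  set Γ : ℝ × ℝ → M := fun q ↦ (c q.1).1 (q.2 : UnitAddCircle) with hΓdef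
  have hΓ : ContMDiff 𝓘(ℝ, ℝ × ℝ) 𝓘(ℝ, E) ∞ Γ := hc.loop
  have hζ (i : Fin (N + 1)) : ContDiff ℝ ∞ fun s ↦ ((c s).2 : CSpace N) i :=
    (contDiff_piLp 2).1 hc.sphere i
  have hz0 : (c 0).2 = z := by rw [hc0]
  have hΓ0 (t : ℝ) : Γ (0, t) = γ t := by simp only [hΓdef, hc0]
  obtain ⟨α, hα, hα0, hαarg⟩ := exists_smooth_circleArg (r := r) (hζ j) (by rwa [hz0])
    (by rw [hz0, hr])
  obtain ⟨C, hC⟩ := exists_loopHam_bound hH (c := fun s ↦ (c s).1) hc.loop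
  obtain ⟨D, -, hDderiv, hD⟩ := exists_first_variation hH σ hΓ (fun s ↦ by
    simp only [hΓdef, AddCircle.coe_period, AddCircle.coe_zero]) hα
  -- With `U` the velocity and `V` the variation field, the density is `ω(V, U) + dH(V + α' U)`, and
  -- `dH(V + α' U) = ω(U, V + α' U) = ω(U, V)`.
  have hD0 (t : ℝ) : D t = 0 := by
    have hsrc := mem_chart_source E (Γ (0, t))
    have hd := (contDiffAt_chart_comp (hΓ (0, t)) hsrc).differentiableAt (by simp)
    have h1 := hD (Γ (0, t)) t hsrc ((contDiffAt_localForm σ _).differentiableAt (by simp))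
    have h2 : fderiv ℝ (fun q ↦ chart E (Γ (0, t)) (Γ q)) (0, t) (0, 1) = γ.velocity t := by
      rw [velocity_eq, ← (hasDerivAt_line_snd hd).deriv]
      simp only [hΓ0]
    rw [h2, hα0, hΓ0, ← mvfderiv_ham hH] at h1
    have h3 := (eq_hamVec_iff σ _ _ _).1 (hγ t)
    set U : E := γ.velocity t
    set V : E := fderiv ℝ (fun q ↦ chart E (γ t) (Γ q)) (0, t) (1, 0)
    have h4 := (extDerivOneForm_eq σ.form (γ t) U (V + deriv α 0 • U)).symm.trans (h3 _)
    rw [h1, ← h4]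
    simp only [map_add, map_smul, _root_.add_apply, _root_.smul_apply]
    ring
  simp only [hD0, intervalIntegral.integral_zero] at hDderiv
  set B : Fin (N + 1) → ℝ → ℝ := fun i s ↦
    loopHam H (c s).1 (circleArg (((c s).2 : CSpace N) i)) + a i with hB
  -- Since `∑ |z_i|² = 1`, the weighted sum of the `B i` equals `B j` plus the sum of these terms.
  -- The term `i = j` is zero and the others have a coordinate vanishing at `s = 0`.
  have hterm (i : Fin (N + 1)) :
      HasDerivAt (fun s ↦ ‖((c s).2 : CSpace N) i‖ ^ 2 * (B i s - B j s)) 0 0 := by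
    by_cases hij : i = j
    · subst hij
      simpa using hasDerivAt_const (0 : ℝ) (0 : ℝ)
    · refine hasDerivAt_norm_sq_mul (C := C + |a i| + (C + |a j|))
        ((hζ i).differentiable (by simp) 0) (by simp only [hz0, hj i hij]) ?_
      filter_upwards [hC] with s hs
      refine (abs_sub _ _).trans (add_le_add ?_ ?_)
      · exact (abs_add_le _ _).trans (add_le_add (hs _) le_rfl)
      · exact (abs_add_le _ _).trans (add_le_add (hs _) le_rfl)
  have hsum := HasDerivAt.fun_sum (u := Finset.univ) fun i _ ↦ hterm i
  have htot := ((hDderiv.neg).sub_const (a j)).sub hsum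
  simp only [neg_zero, Finset.sum_const_zero, sub_zero] at htot
  refine htot.congr_of_eventuallyEq ?_
  filter_upwards [hαarg] with s hs
  have h1 := action_joinExtAdd hH σ a (c s).1 (c s).2
  refine h1.trans ?_
  have h2 : ∑ i, ‖((c s).2 : CSpace N) i‖ ^ 2 * (B i s - B j s) =
      ∑ i, ‖((c s).2 : CSpace N) i‖ ^ 2 * B i s - B j s := by
    simp only [mul_sub, Finset.sum_sub_distrib]
    rw [← Finset.sum_mul, sum_norm_sq, one_mul]
  have h3 : B j s = (∫ t in (0 : ℝ)..1, H ((t - α s : ℝ) : UnitAddCircle) (Γ (s, t))) + a j := by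
    simp only [hB, hs]
    rfl
  simp only [Pi.sub_apply, Pi.neg_apply]
  rw [h2, h3]
  simp only [pullForm_snd σ hΓ]
  simp only [hB, hΓdef]
  ring

end Loop

/-! ### Critical points as circle orbits -/

section Orbits

variable {E : Type*} [NormedAddCommGroup E] [NormedSpace ℝ E] [FiniteDimensional ℝ E]
  {M : Type*} [TopologicalSpace M] [ChartedSpace E M] [IsManifold 𝓘(ℝ, E) ∞ M]
  {H : UnitAddCircle → M → ℝ}
  (hH : ContMDiff (𝓘(ℝ, ℝ).prod 𝓘(ℝ, E)) 𝓘(ℝ, ℝ) ∞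
    (fun p : ℝ × M ↦ H (p.1 : UnitAddCircle) p.2))
include hH

theorem orbits_subset_Crit (σ : ExactSymplectic E M) {N : ℕ} (a : Fin (N + 1) → ℝ) :
    orbits (periodicOrbits σ H ×ˢ range (basisPt N)) ⊆
      Crit (action σ (joinExtAdd H (projFun a))) := by
  rintro _ ⟨τ, ⟨γ, _⟩, ⟨hγ, j, rfl⟩, rfl⟩
  induction τ using QuotientAddGroup.induction_on with
  | H r =>
    have hz (i : Fin (N + 1)) : (sphereRotate (r : UnitAddCircle) (basisPt N j) : CSpace N) i =
        (AddCircle.toCircle (r : UnitAddCircle) : ℂ) * (if i = j then 1 else 0) := by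
      simp [sphereRotate, basisPt]
    have hzj := hz j
    rw [if_pos rfl, mul_one] at hzj
    refine mem_Crit_of_velocity_eq hH σ a (j := j) (r := r) ?_ ?_ ?_ fun t ↦ ?_
    · intro i hi
      rw [hz, if_neg hi, mul_zero]
    · rw [hzj]
      exact Circle.coe_ne_zero _
    · exact circleArg_eq_of_eq_mul one_pos (by rw [hzj]; simp)
    · exact (rotate_velocity γ r t).trans (hγ (t - r))

theorem orbits_eq_Crit_of_hoferNormOn_lt (σ : ExactSymplectic E M) {N : ℕ} (a : Fin (N + 1) → ℝ)
    (K : Set M) (ha : ∀ j : Fin N, hoferNormOn K H < ENNReal.ofReal (a j.succ - a j.castSucc)) :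
    orbits ({γ ∈ periodicOrbits σ H | ∀ θ, γ θ ∈ K} ×ˢ range (basisPt N)) =
      {p ∈ Crit (action σ (joinExtAdd H (projFun a))) | ∀ θ, p.1 θ ∈ K} := by
  refine Subset.antisymm ?_ ?_
  · rintro _ ⟨τ, ⟨γ, z⟩, ⟨⟨hγ, hK⟩, hz⟩, rfl⟩
    exact ⟨orbits_subset_Crit hH σ a ⟨τ, (γ, z), ⟨hγ, hz⟩, rfl⟩, fun θ ↦ hK _⟩
  · rintro ⟨γ, z⟩ ⟨hcrit, hK⟩
    obtain ⟨j, hj⟩ : ∃ j, (z : CSpace N) j ≠ 0 := by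
      by_contra! h
      have h1 := sum_norm_sq z
      simp [h] at h1
    have hj' (i : Fin (N + 1)) (hi : i ≠ j) : (z : CSpace N) i = 0 := by
      by_contra h
      exact hi (eq_of_coord_ne_zero hH σ a hcrit hK ha h hj)
    obtain ⟨r, hr⟩ := QuotientAddGroup.mk_surjective (circleArg ((z : CSpace N) j))
    have hvel := velocity_eq_of_mem_Crit hH σ a hcrit hj' hr.symm
    -- The rotation by the phase of the only nonzero coordinate sends `Z_j` to `z`, since that
    -- coordinate has modulus `1`; rotating `γ` back cancels the delay. Both rotations preserve the
    -- image of the loop, hence the condition on `K`.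
    refine ⟨circleArg ((z : CSpace N) j), (γ.rotate (-circleArg ((z : CSpace N) j)), basisPt N j),
      ⟨⟨fun t ↦ ?_, fun θ ↦ hK _⟩, j, rfl⟩, Prod.ext ?_ ?_⟩
    · rw [← hr]
      have h1 := (rotate_velocity γ (-r) t).trans (hvel (t - -r))
      rw [show t - -r - r = t by ring] at h1
      exact h1
    · exact (rotate_rotate_neg γ _).symm
    · have hzj : ‖(z : CSpace N) j‖ = 1 := by
        have h1 : ‖(z : CSpace N) j‖ ^ 2 = 1 :=
          (Finset.sum_eq_single j (fun i _ hi ↦ by simp [hj' i hi]) (by simp)).symm.trans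
            (sum_norm_sq z)
        exact (pow_eq_one_iff_of_nonneg (norm_nonneg _) two_ne_zero).1 h1
      refine Subtype.ext (PiLp.ext fun i ↦ ?_)
      have h2 := norm_mul_toCircle_circleArg ((z : CSpace N) j)
      rw [hzj, Complex.ofReal_one, one_mul] at h2
      by_cases hi : i = j
      · subst hi
        simp [sphereRotate, basisPt, h2]
      · simp [sphereRotate, basisPt, hi, hj' i hi]

end Orbits

end JoinExtension

open JoinExtension
theorem lemma2p13 {E : Type*} [NormedAddCommGroup E] [NormedSpace ℝ E] [FiniteDimensional ℝ E]
    {M : Type*} [TopologicalSpace M] [T2Space M] [SecondCountableTopology M]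
    [ChartedSpace E M] [IsManifold 𝓘(ℝ, E) ∞ M]
    (σ : ExactSymplectic E M)
    (H : UnitAddCircle → M → ℝ)
    (hH : ContMDiff (𝓘(ℝ, ℝ).prod 𝓘(ℝ, E)) 𝓘(ℝ, ℝ) ∞
      (fun p : ℝ × M ↦ H (p.1 : UnitAddCircle) p.2))
    (N : ℕ) (a : Fin (N + 1) → ℝ) :
    -- (i)
    orbits (periodicOrbits σ H ×ˢ range (basisPt N)) ⊆
        Crit (action σ (joinExtAdd H (projFun a))) ∧
    -- (ii)
    ((∀ j : Fin N, hoferNorm H < ENNReal.ofReal (a j.succ - a j.castSucc)) →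
      orbits (periodicOrbits σ H ×ˢ range (basisPt N)) =
        Crit (action σ (joinExtAdd H (projFun a)))) ∧
    -- (ii), for the loops contained in a subset on which the Hofer norm is computed
    (∀ K : Set M,
      (∀ j : Fin N, hoferNormOn K H < ENNReal.ofReal (a j.succ - a j.castSucc)) →
      orbits ({γ ∈ periodicOrbits σ H | ∀ θ, γ θ ∈ K} ×ˢ range (basisPt N)) =
        {p ∈ Crit (action σ (joinExtAdd H (projFun a))) | ∀ θ, p.1 θ ∈ K}) := by
  refine ⟨orbits_subset_Crit hH σ a, fun ha ↦ ?_, orbits_eq_Crit_of_hoferNormOn_lt hH σ a⟩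
  simpa using orbits_eq_Crit_of_hoferNormOn_lt hH σ a univ ha
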